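/- Let $H\in(0,1)$, let $d\ge 2$ be an integer and let $T>0$. Let $B^H=\{B^H_t,\ t\ge 0\}$ and $\widetilde B^H=\{\widetilde B^H_t,\ t\ge 0\}$ be two independent $d$-dimensional fractional Brownian motions with Hurst index $H$ on a probability space $(\Omega,\mathcal F,P)$, that is, independent centered $\mathbb R^d$-valued Gaussian processes with $(t,\omega)\mapsto B^H_t(\omega)$ and $(t,\omega)\mapsto\widetilde B^H_t(\omega)$ jointly measurable on $[0,T]\times\Omega$ up to a $dt\otimes P$-null set (for instance, with almost surely continuous paths) and $$\mathbb E[B_t^{H,i}B_s^{H,j}]=\mathbb E[\widetilde B_t^{H,i}\widetilde B_s^{H,j}]=\delta_{ij}\,\tfrac12\left(t^{2H}+s^{2H}-|t-s|^{2H}\right),\qquad 1\le i,j\le d,\ s,t\ge 0 .$$ For $\varepsilon>0$ let $p_\varepsilon(x)=(2\pi\varepsilon)^{-d/2}\exp(-|x|^2/(2\varepsilon))$, $x\in\mathbb R^d$, be the heat kernel, and put $$I_\varepsilon=\int_0^T\int_0^T p_\varepsilon(B^H_t-\widetilde B^H_s)\,ds\,dt .$$ Then $I_\varepsilon\in L^2(\Omega)$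 for every $\varepsilon>0$, and: (i) if $Hd<2$, then $I_\varepsilon$ converges in $L^2(\Omega)$ as $\varepsilon\downarrow 0$; (ii) if $Hd\ge 2$, then $\lim_{\varepsilon\downarrow 0}\mathbb E[I_\varepsilon]=+\infty$ and $\lim_{\varepsilon\downarrow 0}\mathrm{Var}[I_\varepsilon]=+\infty$. Consequently $I_\varepsilon$ converges in $L^2(\Omega)$ as $\varepsilon\downarrow 0$, i.e. the intersection local time exists in $L^2$, if and only if $Hd<2$. -/

import Mathlib

open MeasureTheory ProbabilityTheory Filter Topology
open scoped NNReal ENNReal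

/-- The covariance function `R_H(s, t) = (t^{2H} + s^{2H} - |t - s|^{2H}) / 2` of the
one-dimensional fractional Brownian motion with Hurst index `H`. -/
noncomputable def fbmCov (H : ℝ) (s t : ℝ≥0) : ℝ :=
  (1 / 2) * ((t : ℝ) ^ (2 * H) + (s : ℝ) ^ (2 * H) - |(t : ℝ) - (s : ℝ)| ^ (2 * H))

/-- `B` is a `d`-dimensional fractional Brownian motion with Hurst index `H` under `P`:
a centered Gaussian process indexed by `t ≥ 0`, with values in `ℝ^d`, such that
`E[B_t^i B_s^j] = δ_{ij} R_H(s, t)`. -/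
structure IsFractionalBrownianMotion {Ω : Type*} [MeasurableSpace Ω] {d : ℕ} (H : ℝ)
    (B : ℝ≥0 → Ω → EuclideanSpace ℝ (Fin d)) (P : Measure Ω) : Prop where
  isGaussianProcess : IsGaussianProcess B P
  centered : ∀ (t : ℝ≥0) (i : Fin d), ∫ ω, B t ω i ∂P = 0
  covariance : ∀ (s t : ℝ≥0) (i j : Fin d),
    ∫ ω, B t ω i * B s ω j ∂P = if i = j then fbmCov H s t else 0

/-- The heat kernel `p_ε(x) = (2πε)^{-d/2} exp(-|x|² / (2ε))` on `ℝ^d`. -/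
noncomputable def heatKernel {d : ℕ} (ε : ℝ) (x : EuclideanSpace ℝ (Fin d)) : ℝ :=
  (2 * Real.pi * ε) ^ (-(d : ℝ) / 2) * Real.exp (-‖x‖ ^ 2 / (2 * ε))

/-- The approximated intersection local time
`I_ε(B, B') = ∫_0^T ∫_0^T p_ε(B_t - B'_s) ds dt`, as a random variable
(for `t` in `[0, T]`, `t.toNNReal` is `t` regarded as an element of the index set `ℝ≥0`). -/
noncomputable def approxILT {Ω : Type*} {d : ℕ} (B B' : ℝ≥0 → Ω → EuclideanSpace ℝ (Fin d))
    (T : ℝ) (ε : ℝ) (ω : Ω) : ℝ :=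
  ∫ t in (0 : ℝ)..T, ∫ s in (0 : ℝ)..T, heatKernel ε (B t.toNNReal ω - B' s.toNNReal ω)

/-- Joint measurability of a process on `[0, T] × Ω`, up to a null set of Lebesgue measure times
`P`. It holds for instance when almost all paths are continuous. -/
def IsJointlyAEMeasurable {Ω : Type*} [MeasurableSpace Ω] {d : ℕ}
    (B : ℝ≥0 → Ω → EuclideanSpace ℝ (Fin d)) (T : ℝ) (P : Measure Ω) : Prop :=
  AEMeasurable (fun p : ℝ × Ω => B p.1.toNNReal p.2) ((volume.restrict (Set.Icc 0 T)).prod P)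

/-- The family of square-integrable random variables `I ε`, `ε > 0`, converges in `L²(P)`
as `ε ↓ 0`, to some square-integrable limit. -/
def ConvergesInL2 {Ω : Type*} [MeasurableSpace Ω] (I : ℝ → Ω → ℝ) (P : Measure Ω) : Prop :=
  (∀ ε : ℝ, 0 < ε → MemLp (I ε) 2 P) ∧
    ∃ L : Ω → ℝ, MemLp L 2 P ∧
      Tendsto (fun ε : ℝ => eLpNorm (I ε - L) 2 P) (𝓝[>] 0) (𝓝 0)

/-! ### Gaussian integrals and Fourier representation of the heat kernel -/

section HeatKernel

variable {d : ℕ}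

/-! The moments of the approximated local time are explicit. Writing each heat kernel as a Fourier
integral and using the Gaussian characteristic function of the pair `(B_t - B'_s, B_u - B'_v)` gives
`E[I_ε I_η] = (2π)^{-d} ∫ ((a+ε)(b+η) - c²)^{-d/2}` over quadruples of times, where `a`, `b` are the
variances and `c` the covariance of one coordinate (`integral_heatKernel_mul_heatKernel`,
`integral_approxILT_mul`). The mean is `(2π)^{-d/2} ∫ (a+ε)^{-d/2}` over pairs of times.

If `Hd < 2`, local nondeterminism bounds the limit determinant `ab - c²` below by a multiple of
`(min(t,u)|t-u|)^{2H} + (min(s,v)|s-v|)^{2H}`. Bounding this sum below by a geometric mean makes the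
kernel at most a product of singularities of order `Hd/2 < 1`, which is integrable. Dominated
convergence then yields a joint limit of `E[I_ε I_η]`, and such a limit makes the family Cauchy in
`L²` (`convergesInL2_of_tendsto_integral_mul`).

If `Hd ≥ 2`, Fatou's lemma reduces both divergences to infinite integrals at `ε = 0`. By
self-similarity, halving all times multiplies the mean kernel by `2^{Hd} ≥ 2²` and the variance
kernel by `2^{2Hd} ≥ 2⁴`, at least the inverse Jacobian in each case; a positive function with this
property is not integrable near the origin (`setLIntegral_eq_top_of_two_pow_mul_le`). For the
variance, positivity comes from `c > 0`. Divergence of the means alone already rules out convergence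
in `L²`. -/

lemma heatKernel_nonneg {ε : ℝ} (hε : 0 ≤ ε) (x : EuclideanSpace ℝ (Fin d)) :
    0 ≤ heatKernel ε x := by
  unfold heatKernel; positivity

lemma heatKernel_le {ε : ℝ} (hε : 0 ≤ ε) (x : EuclideanSpace ℝ (Fin d)) :
    heatKernel ε x ≤ (2 * Real.pi * ε) ^ (-(d : ℝ) / 2) := by
  unfold heatKernel
  refine mul_le_of_le_one_right (by positivity) (Real.exp_le_one_iff.2 ?_)
  rw [neg_div]
  exact neg_nonpos.2 (by positivity)

lemma continuous_heatKernel (ε : ℝ) :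
    Continuous (heatKernel ε : EuclideanSpace ℝ (Fin d) → ℝ) := by
  unfold heatKernel; fun_prop

lemma heatKernel_zero {ε : ℝ} :
    heatKernel ε (0 : EuclideanSpace ℝ (Fin d)) = (2 * Real.pi * ε) ^ (-(d : ℝ) / 2) := by
  simp [heatKernel]

/-- The integrand of the Fourier representation of the heat kernel. -/
noncomputable def heatFourier (ε : ℝ) (x ξ : EuclideanSpace ℝ (Fin d)) : ℂ :=
  Complex.exp (-((ε / 2 : ℝ) : ℂ) * (‖ξ‖ : ℂ) ^ 2 + Complex.I * (inner ℝ x ξ : ℝ))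

lemma integrable_heatFourier {ε : ℝ} (hε : 0 < ε) (x : EuclideanSpace ℝ (Fin d)) :
    Integrable (heatFourier ε x) :=
  GaussianFourier.integrable_cexp_neg_mul_sq_norm_add
    (by rw [Complex.ofReal_re]; positivity) Complex.I x

lemma norm_heatFourier (ε : ℝ) (x ξ : EuclideanSpace ℝ (Fin d)) :
    ‖heatFourier ε x ξ‖ = Real.exp (-(ε / 2) * ‖ξ‖ ^ 2) := by
  rw [heatFourier, Complex.norm_exp]
  congr 1
  simp [← Complex.ofReal_pow]

lemma integral_heatFourier {ε : ℝ} (hε : 0 < ε) (x : EuclideanSpace ℝ (Fin d)) :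
    ∫ ξ, heatFourier ε x ξ = (((2 * Real.pi) ^ (d : ℝ) * heatKernel ε x : ℝ) : ℂ) := by
  have hb : 0 < (((ε / 2 : ℝ) : ℂ)).re := by rw [Complex.ofReal_re]; positivity
  have h := GaussianFourier.integral_cexp_neg_mul_sq_norm_add hb Complex.I x
  unfold heatFourier
  rw [h, finrank_euclideanSpace, Fintype.card_fin, heatKernel]
  have hpi := Real.pi_pos
  have h1 : (2 * Real.pi) ^ (d : ℝ) * ((2 * Real.pi * ε) ^ (-(d : ℝ) / 2) *
      Real.exp (-‖x‖ ^ 2 / (2 * ε))) =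
      (Real.pi / (ε / 2)) ^ ((d : ℝ) / 2) * Real.exp (-‖x‖ ^ 2 / (4 * (ε / 2))) := by
    rw [← mul_assoc]
    congr 1
    · rw [show Real.pi / (ε / 2) = (2 * Real.pi) ^ (2 : ℝ) * (2 * Real.pi * ε)⁻¹ by
        rw [Real.rpow_two]; field_simp]
      rw [Real.mul_rpow (x := (2 * Real.pi) ^ (2 : ℝ)) (by positivity) (by positivity), ← Real.rpow_mul (by positivity),
        Real.inv_rpow (by positivity), ← Real.rpow_neg (by positivity)]
      congr 2 <;> ring
    · congr 1; ring
  rw [h1, Complex.ofReal_mul, Complex.ofReal_cpow (by positivity)]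
  simp [neg_div]

lemma integral_rexp_neg_mul_sq_norm_add_inner {b : ℝ} (hb : 0 < b) (c : ℝ)
    (w : EuclideanSpace ℝ (Fin d)) :
    ∫ v, Real.exp (-b * ‖v‖ ^ 2 + c * inner ℝ w v) =
      (Real.pi / b) ^ ((d : ℝ) / 2) * Real.exp (c ^ 2 * ‖w‖ ^ 2 / (4 * b)) := by
  have h := GaussianFourier.integral_cexp_neg_mul_sq_norm_add (b := (b : ℂ))
    (by simpa using hb) (c : ℂ) w
  rw [finrank_euclideanSpace, Fintype.card_fin] at h
  have hpi := Real.pi_pos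
  apply Complex.ofReal_injective
  rw [← integral_complex_ofReal, Complex.ofReal_mul, Complex.ofReal_cpow (by positivity)]
  push_cast
  exact h

/-- Gaussian integral of a positive definite quadratic form with scalar blocks. -/
lemma integral_rexp_quadratic_prod {a b c : ℝ} (hb : 0 < b) (hdet : 0 < a * b - c ^ 2)
    (hint : Integrable (fun z : EuclideanSpace ℝ (Fin d) × EuclideanSpace ℝ (Fin d) =>
      Real.exp (-(a * ‖z.1‖ ^ 2 + 2 * c * inner ℝ z.1 z.2 + b * ‖z.2‖ ^ 2) / 2))) :
    ∫ z : EuclideanSpace ℝ (Fin d) × EuclideanSpace ℝ (Fin d),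
      Real.exp (-(a * ‖z.1‖ ^ 2 + 2 * c * inner ℝ z.1 z.2 + b * ‖z.2‖ ^ 2) / 2) =
      (2 * Real.pi) ^ (d : ℝ) * (a * b - c ^ 2) ^ (-(d : ℝ) / 2) := by
  have hpi := Real.pi_pos
  have hk : 0 < (a * b - c ^ 2) / (2 * b) := by positivity
  have key : ∀ x : EuclideanSpace ℝ (Fin d),
      ∫ y, Real.exp (-(a * ‖x‖ ^ 2 + 2 * c * inner ℝ x y + b * ‖y‖ ^ 2) / 2) =
      (Real.pi / (b / 2)) ^ ((d : ℝ) / 2) *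
        Real.exp (-((a * b - c ^ 2) / (2 * b)) * ‖x‖ ^ 2) := by
    intro x
    have h := integral_rexp_neg_mul_sq_norm_add_inner (b := b / 2) (by positivity) (-c) x
    calc _ = ∫ y, Real.exp (-(a / 2) * ‖x‖ ^ 2) *
          Real.exp (-(b / 2) * ‖y‖ ^ 2 + (-c) * inner ℝ x y) := by
          congr 1; ext y; rw [← Real.exp_add]; congr 1; ring
      _ = _ := by
          rw [integral_const_mul, h, mul_left_comm, ← Real.exp_add]
          congr 2; field_simp; ring
  rw [Measure.volume_eq_prod, integral_prod _ (by rwa [← Measure.volume_eq_prod])]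
  simp_rw [key]
  rw [integral_const_mul, GaussianFourier.integral_rexp_neg_mul_sq_norm hk,
    finrank_euclideanSpace, Fintype.card_fin, ← Real.mul_rpow (by positivity) (by positivity),
    show Real.pi / (b / 2) * (Real.pi / ((a * b - c ^ 2) / (2 * b))) =
      (2 * Real.pi) ^ (2 : ℝ) * (a * b - c ^ 2)⁻¹ by
        rw [Real.rpow_two]; field_simp,
    Real.mul_rpow (by positivity) (by positivity), ← Real.rpow_mul (by positivity),
    Real.inv_rpow hdet.le, ← Real.rpow_neg hdet.le]
  congr 2 <;> ring

variable {Ω : Type*} [MeasurableSpace Ω] {P : Measure Ω}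

/-- Expand both kernels as Fourier integrals and exchange with the expectation: the characteristic
function contributes the quadratic form `(a, c, b)`, the damping factors add `ε` and `η` to its
diagonal, and a Gaussian integral over the two frequencies remains. -/
lemma integral_heatKernel_mul_heatKernel [IsFiniteMeasure P]
    {X Y : Ω → EuclideanSpace ℝ (Fin d)} (hX : AEMeasurable X P) (hY : AEMeasurable Y P)
    {a b c : ℝ} (ha : 0 ≤ a) (hb : 0 ≤ b) (hc : c ^ 2 ≤ a * b)
    (hchar : ∀ ξ ζ, ∫ ω, Complex.exp (Complex.I * ((inner ℝ (X ω) ξ + inner ℝ (Y ω) ζ : ℝ))) ∂P =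
      ((Real.exp (-(a * ‖ξ‖ ^ 2 + 2 * c * inner ℝ ξ ζ + b * ‖ζ‖ ^ 2) / 2) : ℝ) : ℂ))
    {ε η : ℝ} (hε : 0 < ε) (hη : 0 < η) :
    ∫ ω, heatKernel ε (X ω) * heatKernel η (Y ω) ∂P =
      (2 * Real.pi) ^ (-(d : ℝ)) * ((a + ε) * (b + η) - c ^ 2) ^ (-(d : ℝ) / 2) := by
  let F : Ω → EuclideanSpace ℝ (Fin d) × EuclideanSpace ℝ (Fin d) → ℂ := fun ω z =>
    heatFourier ε (X ω) z.1 * heatFourier η (Y ω) z.2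
  let g : EuclideanSpace ℝ (Fin d) × EuclideanSpace ℝ (Fin d) → ℝ := fun z =>
    Real.exp (-(ε / 2) * ‖z.1‖ ^ 2) * Real.exp (-(η / 2) * ‖z.2‖ ^ 2)
  have hg : Integrable g := by
    have h := (integrable_heatFourier hε (0 : EuclideanSpace ℝ (Fin d))).norm.mul_prod
      (integrable_heatFourier hη (0 : EuclideanSpace ℝ (Fin d))).norm
    simp only [norm_heatFourier] at h
    exact h
  have hFg : ∀ ω z, ‖F ω z‖ = g z := fun ω z => by
    simp only [F, g, norm_mul, norm_heatFourier]
  have hFm : AEStronglyMeasurable (Function.uncurry F) (P.prod volume) := by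
    have h1 : AEMeasurable (fun p : Ω × (EuclideanSpace ℝ (Fin d) × EuclideanSpace ℝ (Fin d)) =>
        X p.1) (P.prod volume) := hX.comp_fst
    have h2 : AEMeasurable (fun p : Ω × (EuclideanSpace ℝ (Fin d) × EuclideanSpace ℝ (Fin d)) =>
        Y p.1) (P.prod volume) := hY.comp_fst
    refine AEMeasurable.aestronglyMeasurable ?_
    simp only [Function.uncurry_def, F, heatFourier]
    have h3 := h1.inner (𝕜 := ℝ) (measurable_fst.comp measurable_snd).aemeasurable
    have h4 := h2.inner (𝕜 := ℝ) (measurable_snd.comp measurable_snd).aemeasurable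
    simp only [Function.comp_def] at h3 h4
    fun_prop
  have hFi : Integrable (Function.uncurry F) (P.prod volume) := by
    refine Integrable.mono' (hg.comp_snd P) hFm (ae_of_all _ fun p => ?_)
    exact (hFg p.1 p.2).le
  have hF1 : ∀ ω, ∫ z, F ω z = ((((2 * Real.pi) ^ (d : ℝ)) ^ 2 *
      (heatKernel ε (X ω) * heatKernel η (Y ω)) : ℝ) : ℂ) := fun ω => by
    simp only [F]
    rw [Measure.volume_eq_prod, integral_prod_mul, integral_heatFourier hε, integral_heatFourier hη]
    push_cast; ring
  let q : EuclideanSpace ℝ (Fin d) × EuclideanSpace ℝ (Fin d) → ℝ := fun z =>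
    Real.exp (-((a + ε) * ‖z.1‖ ^ 2 + 2 * c * inner ℝ z.1 z.2 + (b + η) * ‖z.2‖ ^ 2) / 2)
  have hF2 : ∀ z, ∫ ω, F ω z ∂P = (q z : ℂ) := fun z => by
    have h1 : ∀ ω, F ω z = (g z : ℂ) *
        Complex.exp (Complex.I * ((inner ℝ (X ω) z.1 + inner ℝ (Y ω) z.2 : ℝ))) := fun ω => by
      simp only [F, g, heatFourier]
      push_cast
      rw [← Complex.exp_add, ← Complex.exp_add, ← Complex.exp_add]
      congr 1; ring
    simp_rw [h1]
    rw [integral_const_mul, hchar, ← Complex.ofReal_mul]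
    congr 1
    simp only [g, q]
    rw [← Real.exp_add, ← Real.exp_add]
    congr 1; ring
  -- Integrability of the Gaussian in the frequencies comes for free: it is the `P`-marginal of a
  -- function integrable on the product.
  have hqi : Integrable q := by
    have h := hFi.integral_prod_right
    simp only [Function.uncurry_apply_pair, hF2] at h
    exact h.re
  have hswap := integral_integral_swap hFi
  simp_rw [hF1, hF2] at hswap
  rw [integral_complex_ofReal, integral_complex_ofReal, Complex.ofReal_inj, integral_const_mul,
    integral_rexp_quadratic_prod (by positivity) (by nlinarith [mul_pos hε hη]) hqi] at hswap
  have hpi := Real.pi_pos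
  have hne : (2 * Real.pi) ^ (d : ℝ) ≠ 0 := by positivity
  rw [Real.rpow_neg (by positivity)]
  have h3 : (2 * Real.pi) ^ (d : ℝ) * ((2 * Real.pi) ^ (d : ℝ) *
      ∫ ω, heatKernel ε (X ω) * heatKernel η (Y ω) ∂P) =
      (2 * Real.pi) ^ (d : ℝ) * ((a + ε) * (b + η) - c ^ 2) ^ (-(d : ℝ) / 2) := by
    rw [← hswap]; ring
  rw [← mul_left_cancel₀ hne h3, inv_mul_cancel_left₀ hne]

lemma integral_heatKernel_eq [IsProbabilityMeasure P]
    {X : Ω → EuclideanSpace ℝ (Fin d)} (hX : AEMeasurable X P) {a : ℝ} (ha : 0 ≤ a)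
    (hchar : ∀ ξ, ∫ ω, Complex.exp (Complex.I * ((inner ℝ (X ω) ξ : ℝ))) ∂P =
      ((Real.exp (-(a * ‖ξ‖ ^ 2) / 2) : ℝ) : ℂ))
    {ε : ℝ} (hε : 0 < ε) :
    ∫ ω, heatKernel ε (X ω) ∂P = (2 * Real.pi) ^ (-(d : ℝ) / 2) * (a + ε) ^ (-(d : ℝ) / 2) := by
  -- The one-variable formula is the two-variable one with `Y = 0` and `η = 1`, whose kernel is a
  -- nonzero constant to be cancelled.
  have h := integral_heatKernel_mul_heatKernel hX
    (aemeasurable_const (b := (0 : EuclideanSpace ℝ (Fin d)))) ha le_rfl (c := 0) (by simp)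
    (by simpa using hchar) hε one_pos
  simp only [heatKernel_zero, mul_one, zero_add, ne_eq, OfNat.ofNat_ne_zero, not_false_eq_true,
    zero_pow, sub_zero] at h
  rw [integral_mul_const] at h
  have hpi := Real.pi_pos
  have hne : (2 * Real.pi) ^ (-(d : ℝ) / 2) ≠ 0 := by positivity
  apply mul_right_cancel₀ hne
  rw [h, mul_right_comm, ← Real.rpow_add (by positivity)]
  congr 2; ring

end HeatKernel

/-! ### Characteristic functions of fractional Brownian motion -/

section FractionalBrownianMotion

variable {Ω : Type*} [MeasurableSpace Ω] {P : Measure Ω} {d : ℕ} {H : ℝ}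
  {B B' : ℝ≥0 → Ω → EuclideanSpace ℝ (Fin d)}

lemma fbmCov_comm (H : ℝ) (s t : ℝ≥0) : fbmCov H s t = fbmCov H t s := by
  unfold fbmCov; rw [abs_sub_comm]; ring

lemma fbmCov_self {H : ℝ} (hH : 0 < H) (t : ℝ≥0) : fbmCov H t t = (t : ℝ) ^ (2 * H) := by
  unfold fbmCov
  rw [sub_self, abs_zero, Real.zero_rpow (by positivity)]; ring

lemma IsFractionalBrownianMotion.aemeasurable (hB : IsFractionalBrownianMotion H B P) (t : ℝ≥0) :
    AEMeasurable (B t) P := hB.isGaussianProcess.aemeasurable t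

lemma IsFractionalBrownianMotion.memLp_coord (hB : IsFractionalBrownianMotion H B P) (t : ℝ≥0)
    (i : Fin d) : MemLp (fun ω => B t ω i) 2 P :=
  ((hB.isGaussianProcess.hasGaussianLaw_eval t).map_fun
    (EuclideanSpace.proj i : EuclideanSpace ℝ (Fin d) →L[ℝ] ℝ)).memLp_two

lemma inner_eq_sum_mul (x ξ : EuclideanSpace ℝ (Fin d)) : inner ℝ x ξ = ∑ i, x i * ξ i := by
  rw [PiLp.inner_apply]
  exact Finset.sum_congr rfl fun i _ => by simp [mul_comm]

lemma IsFractionalBrownianMotion.memLp_inner (hB : IsFractionalBrownianMotion H B P) (t : ℝ≥0)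
    (ξ : EuclideanSpace ℝ (Fin d)) : MemLp (fun ω => inner ℝ (B t ω) ξ) 2 P := by
  simp_rw [inner_eq_sum_mul]
  exact memLp_finsetSum _ fun i _ => (hB.memLp_coord t i).mul_const _

lemma IsFractionalBrownianMotion.integral_inner [IsFiniteMeasure P]
    (hB : IsFractionalBrownianMotion H B P)
    (t : ℝ≥0) (ξ : EuclideanSpace ℝ (Fin d)) : ∫ ω, inner ℝ (B t ω) ξ ∂P = 0 := by
  simp_rw [inner_eq_sum_mul]
  rw [integral_finsetSum _ fun i _ =>
    ((hB.memLp_coord t i).integrable one_le_two).mul_const _]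
  simp [integral_mul_const, hB.centered]

lemma IsFractionalBrownianMotion.integral_inner_mul_inner (hB : IsFractionalBrownianMotion H B P)
    (t u : ℝ≥0) (ξ ζ : EuclideanSpace ℝ (Fin d)) :
    ∫ ω, inner ℝ (B t ω) ξ * inner ℝ (B u ω) ζ ∂P = fbmCov H t u * inner ℝ ξ ζ := by
  simp_rw [inner_eq_sum_mul, Finset.sum_mul_sum]
  have hi : ∀ i j, Integrable (fun ω => B t ω i * ξ i * (B u ω j * ζ j)) P := fun i j =>
    ((hB.memLp_coord t i).mul_const _).integrable_mul ((hB.memLp_coord u j).mul_const _)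
  rw [integral_finsetSum _ fun i _ => integrable_finsetSum _ fun j _ => hi i j]
  simp_rw [integral_finsetSum _ fun j _ => hi _ j]
  have h : ∀ i j, ∫ ω, B t ω i * ξ i * (B u ω j * ζ j) ∂P =
      if i = j then fbmCov H t u * (ξ i * ζ j) else 0 := fun i j => by
    calc _ = ∫ ω, (B t ω i * B u ω j) * (ξ i * ζ j) ∂P := by congr 1; ext ω; ring
      _ = _ := by
        rw [integral_mul_const, hB.covariance]
        split_ifs
        · rw [fbmCov_comm]
        · simp
  simp [h, Finset.mul_sum]

lemma IsFractionalBrownianMotion.integral_cexp_inner_add_inner (hH : 0 < H)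
    [IsProbabilityMeasure P] (hB : IsFractionalBrownianMotion H B P)
    (t u : ℝ≥0) (ξ ζ : EuclideanSpace ℝ (Fin d)) :
    ∫ ω, Complex.exp (Complex.I * ((inner ℝ (B t ω) ξ + inner ℝ (B u ω) ζ : ℝ))) ∂P =
      ((Real.exp (-((t : ℝ) ^ (2 * H) * ‖ξ‖ ^ 2 + 2 * fbmCov H t u * inner ℝ ξ ζ +
        (u : ℝ) ^ (2 * H) * ‖ζ‖ ^ 2) / 2) : ℝ) : ℂ) := by
  let L : EuclideanSpace ℝ (Fin d) × EuclideanSpace ℝ (Fin d) →L[ℝ] ℝ :=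
    (innerSL ℝ ξ).comp (.fst ℝ _ _) + (innerSL ℝ ζ).comp (.snd ℝ _ _)
  have hL : ∀ ω, L (B t ω, B u ω) = inner ℝ (B t ω) ξ + inner ℝ (B u ω) ζ := fun ω => by
    simp [L, real_inner_comm]
  have hZ : HasGaussianLaw (fun ω => inner ℝ (B t ω) ξ + inner ℝ (B u ω) ζ) P := by
    simpa only [hL] using (hB.isGaussianProcess.hasGaussianLaw_prodMk (s := t) (t := u)).map_fun L
  have hmean : ∫ ω, (inner ℝ (B t ω) ξ + inner ℝ (B u ω) ζ) ∂P = 0 := by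
    rw [integral_add ((hB.memLp_inner t ξ).integrable one_le_two)
      ((hB.memLp_inner u ζ).integrable one_le_two), hB.integral_inner, hB.integral_inner, add_zero]
  have hvar : Var[fun ω => inner ℝ (B t ω) ξ + inner ℝ (B u ω) ζ; P] =
      (t : ℝ) ^ (2 * H) * ‖ξ‖ ^ 2 + 2 * fbmCov H t u * inner ℝ ξ ζ +
        (u : ℝ) ^ (2 * H) * ‖ζ‖ ^ 2 := by
    rw [variance_eq_sub hZ.memLp_two, hmean]
    have hI : ∀ r x r' x', Integrable (fun ω => inner ℝ (B r ω) x * inner ℝ (B r' ω) x') P :=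
      fun r x r' x' => (hB.memLp_inner r x).integrable_mul (hB.memLp_inner r' x')
    have hI' : Integrable (fun ω => inner ℝ (B t ω) ξ * inner ℝ (B t ω) ξ +
        2 * (inner ℝ (B t ω) ξ * inner ℝ (B u ω) ζ)) P :=
      (hI t ξ t ξ).add ((hI t ξ u ζ).const_mul 2)
    calc _ = ∫ ω, ((inner ℝ (B t ω) ξ * inner ℝ (B t ω) ξ +
          2 * (inner ℝ (B t ω) ξ * inner ℝ (B u ω) ζ)) +
          inner ℝ (B u ω) ζ * inner ℝ (B u ω) ζ) ∂P := by
          rw [zero_pow two_ne_zero, sub_zero]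
          congr 1; ext ω; simp only [Pi.pow_apply]; ring
      _ = _ := by
          rw [integral_add hI' (hI u ζ u ζ), integral_add (hI t ξ t ξ) ((hI t ξ u ζ).const_mul 2),
            integral_const_mul]
          simp only [hB.integral_inner_mul_inner, fbmCov_self hH, real_inner_self_eq_norm_sq]
          ring
  have hc := hZ.charFun_map_eq (1 : ℝ)
  rw [charFun_apply, integral_map hZ.aemeasurable (by fun_prop)] at hc
  simp only [RCLike.inner_apply, conj_trivial, one_mul, mul_one, hvar] at hc
  rw [hmean] at hc
  calc _ = _ := by simp_rw [mul_comm Complex.I]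
    _ = _ := hc
    _ = _ := by push_cast; congr 1; ring

/-- Joint characteristic function of `(B_t - B'_s, B_u - B'_v)`. -/
lemma integral_cexp_inner_sub_add_inner_sub (hH : 0 < H) [IsProbabilityMeasure P]
    (hB : IsFractionalBrownianMotion H B P) (hB' : IsFractionalBrownianMotion H B' P)
    (hindep : IndepFun (fun ω t => B t ω) (fun ω t => B' t ω) P)
    (t s u v : ℝ≥0) (ξ ζ : EuclideanSpace ℝ (Fin d)) :
    ∫ ω, Complex.exp (Complex.I *
      ((inner ℝ (B t ω - B' s ω) ξ + inner ℝ (B u ω - B' v ω) ζ : ℝ))) ∂P =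
      ((Real.exp (-(((t : ℝ) ^ (2 * H) + (s : ℝ) ^ (2 * H)) * ‖ξ‖ ^ 2 +
        2 * (fbmCov H t u + fbmCov H s v) * inner ℝ ξ ζ +
        ((u : ℝ) ^ (2 * H) + (v : ℝ) ^ (2 * H)) * ‖ζ‖ ^ 2) / 2) : ℝ) : ℂ) := by
  have h1 := hB.integral_cexp_inner_add_inner hH t u ξ ζ
  -- The minus sign in front of `B'` is moved onto the frequencies; the quadratic form is even, so
  -- it disappears.
  have h2 := hB'.integral_cexp_inner_add_inner hH s v (-ξ) (-ζ)
  have hi : IndepFun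
      (fun ω => Complex.exp (Complex.I * ((inner ℝ (B t ω) ξ + inner ℝ (B u ω) ζ : ℝ))))
      (fun ω => Complex.exp (Complex.I * ((inner ℝ (B' s ω) (-ξ) + inner ℝ (B' v ω) (-ζ) : ℝ))))
      P := by
    refine hindep.comp
      (φ := fun x : ℝ≥0 → EuclideanSpace ℝ (Fin d) =>
        Complex.exp (Complex.I * ((inner ℝ (x t) ξ + inner ℝ (x u) ζ : ℝ))))
      (ψ := fun x : ℝ≥0 → EuclideanSpace ℝ (Fin d) =>
        Complex.exp (Complex.I * ((inner ℝ (x s) (-ξ) + inner ℝ (x v) (-ζ) : ℝ)))) ?_ ?_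
    · fun_prop
    · fun_prop
  have hm := hB.aemeasurable
  have hm' := hB'.aemeasurable
  have h := hi.integral_fun_mul_eq_mul_integral
    (AEMeasurable.aestronglyMeasurable (by fun_prop))
    (AEMeasurable.aestronglyMeasurable (by fun_prop))
  rw [h1, h2, ← Complex.ofReal_mul, ← Real.exp_add] at h
  convert h using 1
  · congr 1; ext ω
    rw [← Complex.exp_add, ← mul_add, ← Complex.ofReal_add]
    congr 3
    simp only [inner_sub_left, inner_neg_right]; ring
  · congr 2
    simp only [norm_neg, inner_neg_neg]; ring

end FractionalBrownianMotion

/-! ### Local nondeterminism: lower bounds for covariance determinants -/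

section LocalNondeterminism

variable {H : ℝ}

lemma two_sub_two_rpow_pos (hH1 : H < 1) : 0 < 2 - (2 : ℝ) ^ H := by
  have h := Real.rpow_lt_rpow_of_exponent_lt (x := 2) (by norm_num) hH1
  rw [Real.rpow_one] at h
  linarith

/-- Both `y` and `2x` are convex combinations of `x` and `x + y`, with the weights `x/y` and
`(y-x)/y` exchanged. Adding the two concavity inequalities for the power `H` makes the weights sum
to one. -/
lemma rpow_add_rpow_sub_rpow_add_ge (hH0 : 0 < H) (hH1 : H < 1) {x y : ℝ} (hx : 0 ≤ x)
    (hxy : x ≤ y) : (2 - 2 ^ H) * x ^ H ≤ x ^ H + y ^ H - (x + y) ^ H := by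
  rcases (hx.trans hxy).eq_or_lt with hy | hy
  · obtain rfl : x = 0 := le_antisymm (hy ▸ hxy) hx
    simp [← hy, Real.zero_rpow hH0.ne']
  have hc := (Real.concaveOn_rpow hH0.le hH1.le).2
  have h0 : 0 ≤ (y - x) / y := div_nonneg (by linarith) hy.le
  have h1 : 0 ≤ x / y := by positivity
  have h01 : (y - x) / y + x / y = 1 := by field_simp; ring
  have hA := hc (x := x) (y := x + y) hx (Set.mem_Ici.2 (by positivity)) h1 h0 (by linarith)
  have hB := hc (x := x) (y := x + y) hx (Set.mem_Ici.2 (by positivity)) h0 h1 h01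
  simp only [smul_eq_mul] at hA hB
  rw [show x / y * x + (y - x) / y * (x + y) = y by field_simp; ring] at hA
  rw [show (y - x) / y * x + x / y * (x + y) = 2 * x by field_simp; ring,
    Real.mul_rpow (by norm_num) hx] at hB
  have hs : (y - x) / y = 1 - x / y := by linarith
  rw [hs] at hA hB
  nlinarith

lemma rpow_two_mul_eq_sq {x : ℝ} (hx : 0 ≤ x) (H : ℝ) : x ^ (2 * H) = (x ^ H) ^ 2 := by
  rw [mul_comm, Real.rpow_mul hx, Real.rpow_two]

/-- Local nondeterminism of fractional Brownian motion for two times, in ordered form. -/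
lemma rpow_mul_rpow_sub_fbmCov_sq_ge_of_lt (hH0 : 0 < H) (hH1 : H < 1) {t u : ℝ≥0} (hut : u ≤ t) :
    (2 - 2 ^ H) / 4 * ((u : ℝ) ^ (2 * H) * |(t : ℝ) - u| ^ (2 * H)) ≤
      (t : ℝ) ^ (2 * H) * (u : ℝ) ^ (2 * H) - fbmCov H t u ^ 2 := by
  have hut' : (u : ℝ) ≤ t := hut
  have hu : (0 : ℝ) ≤ u := u.coe_nonneg
  have ht : (0 : ℝ) ≤ t := t.coe_nonneg
  unfold fbmCov
  rw [abs_sub_comm (u : ℝ) t, abs_of_nonneg (sub_nonneg.2 hut'), rpow_two_mul_eq_sq hu,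
    rpow_two_mul_eq_sq ht, rpow_two_mul_eq_sq (sub_nonneg.2 hut')]
  set a := (t : ℝ) ^ H
  set b := (u : ℝ) ^ H
  set c := ((t : ℝ) - u) ^ H
  have hb : 0 ≤ b := by positivity
  have hc : 0 ≤ c := Real.rpow_nonneg (sub_nonneg.2 hut') _
  have hba : b ≤ a := Real.rpow_le_rpow hu hut' hH0.le
  have hca : c ≤ a := Real.rpow_le_rpow (sub_nonneg.2 hut') (by linarith) hH0.le
  have hk := two_sub_two_rpow_pos hH1
  set k := 2 - (2 : ℝ) ^ H
  -- By Heron's factorization, the determinant is a quarter of `(a+b+c)(b+c-a)(a+b-c)(a+c-b)`. The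
  -- degenerate factor `b + c - a` is at least `k` times the smaller of `b` and `c`, and `a + b + c`
  -- dominates the other one.
  have hkey : k * (b * c) ≤ (b + c - a) * (a + b + c) := by
    rcases le_total (u : ℝ) (t - u) with h | h
    · have h1 := rpow_add_rpow_sub_rpow_add_ge hH0 hH1 hu h
      rw [add_sub_cancel] at h1
      have h2 : k * b ≤ b + c - a := h1
      calc k * (b * c) = k * b * c := by ring
        _ ≤ (b + c - a) * (a + b + c) :=
          mul_le_mul h2 (by linarith) hc ((mul_nonneg hk.le hb).trans h2)
    · have h1 := rpow_add_rpow_sub_rpow_add_ge hH0 hH1 (sub_nonneg.2 hut') h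
      rw [sub_add_cancel] at h1
      have h2 : k * c ≤ b + c - a := by linarith [show k * c ≤ c + b - a from h1]
      calc k * (b * c) = k * c * b := by ring
        _ ≤ (b + c - a) * (a + b + c) :=
          mul_le_mul h2 (by linarith) hb ((mul_nonneg hk.le hc).trans h2)
  have hbc : b * c ≤ (a + b - c) * (a + c - b) :=
    mul_le_mul (by linarith) (by linarith) hc (by linarith)
  have h3 := mul_le_mul hkey hbc (by positivity)
    ((mul_nonneg hk.le (mul_nonneg hb hc)).trans hkey)
  nlinarith

/-- Local nondeterminism of fractional Brownian motion for two times. -/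
lemma rpow_mul_rpow_sub_fbmCov_sq_ge (hH0 : 0 < H) (hH1 : H < 1) (t u : ℝ≥0) :
    (2 - 2 ^ H) / 4 * (min (t : ℝ) u * |(t : ℝ) - u|) ^ (2 * H) ≤
      (t : ℝ) ^ (2 * H) * (u : ℝ) ^ (2 * H) - fbmCov H t u ^ 2 := by
  rw [Real.mul_rpow (le_min t.coe_nonneg u.coe_nonneg) (abs_nonneg _)]
  rcases le_total u t with h | h
  · rw [min_eq_right (show (u : ℝ) ≤ t from h)]
    exact rpow_mul_rpow_sub_fbmCov_sq_ge_of_lt hH0 hH1 h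
  · rw [min_eq_left (show (t : ℝ) ≤ u from h), abs_sub_comm, fbmCov_comm]
    convert rpow_mul_rpow_sub_fbmCov_sq_ge_of_lt hH0 hH1 h using 2
    rw [mul_comm]

lemma fbmCov_sq_le (hH0 : 0 < H) (hH1 : H < 1) (t u : ℝ≥0) :
    fbmCov H t u ^ 2 ≤ (t : ℝ) ^ (2 * H) * (u : ℝ) ^ (2 * H) := by
  have h := rpow_mul_rpow_sub_fbmCov_sq_ge hH0 hH1 t u
  have hk := two_sub_two_rpow_pos hH1
  have h2 : 0 ≤ (min (t : ℝ) u * |(t : ℝ) - u|) ^ (2 * H) :=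
    Real.rpow_nonneg (mul_nonneg (le_min t.coe_nonneg u.coe_nonneg) (abs_nonneg _)) _
  nlinarith [mul_nonneg hk.le h2]

/-- Since `|t - u| ≤ max t u`, the subtracted power is absorbed by the larger of the other two, and
the smaller one is left. This holds even for `H < 1/2`, where increments are negatively correlated,
and it makes the limit variance kernel strictly positive. -/
lemma fbmCov_pos (hH0 : 0 < H) {t u : ℝ≥0} (ht : 0 < t) (hu : 0 < u) : 0 < fbmCov H t u := by
  unfold fbmCov
  have ht' : (0 : ℝ) < t := ht
  have hu' : (0 : ℝ) < u := hu
  have h1 : (0 : ℝ) < (t : ℝ) ^ (2 * H) := by positivity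
  have h2 : (0 : ℝ) < (u : ℝ) ^ (2 * H) := by positivity
  have h3 : |(t : ℝ) - u| ^ (2 * H) ≤ max (t : ℝ) u ^ (2 * H) :=
    Real.rpow_le_rpow (abs_nonneg _) (by
      rw [abs_le]
      constructor <;> linarith [le_max_left (t : ℝ) u, le_max_right (t : ℝ) u]) (by positivity)
  rw [abs_sub_comm]
  rcases max_choice (t : ℝ) u with h | h <;> rw [h] at h3 <;> linarith

/-- The determinant is superadditive on `2 × 2` positive semidefinite matrices. -/
lemma det_add_det_le {p₁ q₁ r₁ p₂ q₂ r₂ : ℝ} (hp₁ : 0 ≤ p₁) (hr₁ : 0 ≤ r₁) (hp₂ : 0 ≤ p₂)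
    (hr₂ : 0 ≤ r₂) (h₁ : q₁ ^ 2 ≤ p₁ * r₁) (h₂ : q₂ ^ 2 ≤ p₂ * r₂) :
    (p₁ * r₁ - q₁ ^ 2) + (p₂ * r₂ - q₂ ^ 2) ≤ (p₁ + p₂) * (r₁ + r₂) - (q₁ + q₂) ^ 2 := by
  -- The mixed term is controlled by the arithmetic-geometric mean inequality: `(q₁q₂)² ≤
  -- (p₁r₂)(p₂r₁)`.
  have h : |2 * (q₁ * q₂)| ≤ p₁ * r₂ + p₂ * r₁ := by
    apply abs_le_of_sq_le_sq _ (by positivity)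
    have := mul_le_mul h₁ h₂ (sq_nonneg _) (by positivity)
    nlinarith [sq_nonneg (p₁ * r₂ - p₂ * r₁)]
  nlinarith [le_abs_self (2 * (q₁ * q₂))]

/-- Determinant of the covariance matrix of `(B_t^i - B'_s^i, B_u^i - B'_v^i)`. -/
noncomputable def fbmDiffDet (H : ℝ) (t s u v : ℝ≥0) : ℝ :=
  ((t : ℝ) ^ (2 * H) + (s : ℝ) ^ (2 * H)) * ((u : ℝ) ^ (2 * H) + (v : ℝ) ^ (2 * H)) -
    (fbmCov H t u + fbmCov H s v) ^ 2

lemma fbmDiffDet_ge (hH0 : 0 < H) (hH1 : H < 1) (t s u v : ℝ≥0) :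
    (2 - 2 ^ H) / 4 * ((min (t : ℝ) u * |(t : ℝ) - u|) ^ (2 * H) +
      (min (s : ℝ) v * |(s : ℝ) - v|) ^ (2 * H)) ≤ fbmDiffDet H t s u v := by
  have h := det_add_det_le (Real.rpow_nonneg t.coe_nonneg (2 * H)) (Real.rpow_nonneg u.coe_nonneg (2 * H))
    (Real.rpow_nonneg s.coe_nonneg (2 * H)) (Real.rpow_nonneg v.coe_nonneg (2 * H))
    (fbmCov_sq_le hH0 hH1 t u) (fbmCov_sq_le hH0 hH1 s v)
  rw [mul_add]
  exact (add_le_add (rpow_mul_rpow_sub_fbmCov_sq_ge hH0 hH1 t u)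
    (rpow_mul_rpow_sub_fbmCov_sq_ge hH0 hH1 s v)).trans h

lemma fbmDiffDet_nonneg (hH0 : 0 < H) (hH1 : H < 1) (t s u v : ℝ≥0) :
    0 ≤ fbmDiffDet H t s u v := by
  refine le_trans ?_ (fbmDiffDet_ge hH0 hH1 t s u v)
  have hk := two_sub_two_rpow_pos hH1
  have h1 : 0 ≤ (min (t : ℝ) u * |(t : ℝ) - u|) := mul_nonneg (le_min t.coe_nonneg u.coe_nonneg) (abs_nonneg _)
  have h2 : 0 ≤ (min (s : ℝ) v * |(s : ℝ) - v|) := mul_nonneg (le_min s.coe_nonneg v.coe_nonneg) (abs_nonneg _)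
  positivity

lemma fbmDiffDet_pos (hH0 : 0 < H) (hH1 : H < 1) {t s u v : ℝ≥0} (ht : 0 < t) (hu : 0 < u)
    (htu : t ≠ u) : 0 < fbmDiffDet H t s u v := by
  refine lt_of_lt_of_le ?_ (fbmDiffDet_ge hH0 hH1 t s u v)
  have hk := two_sub_two_rpow_pos hH1
  have h0 : (t : ℝ) - u ≠ 0 := sub_ne_zero.2 (by exact_mod_cast htu)
  have h1 : 0 < (min (t : ℝ) u * |(t : ℝ) - u|) := mul_pos (lt_min ht hu) (abs_pos.2 h0)
  have h2 : 0 ≤ (min (s : ℝ) v * |(s : ℝ) - v|) := mul_nonneg (le_min s.coe_nonneg v.coe_nonneg) (abs_nonneg _)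
  positivity

/-- Replacing the sum `x^{2H} + y^{2H}` by the smaller `x^H y^H` separates the two processes; the
singularity of order `Hd` is shared equally, which is where the threshold `Hd/2 < 1` arises. -/
lemma fbmDiffDet_rpow_le (hH0 : 0 < H) (hH1 : H < 1) {t s u v : ℝ≥0} (ht : 0 < t) (hs : 0 < s)
    (hu : 0 < u) (hv : 0 < v) (htu : t ≠ u) (hsv : s ≠ v) (d : ℕ) :
    fbmDiffDet H t s u v ^ (-(d : ℝ) / 2) ≤ ((2 - 2 ^ H) / 4) ^ (-(d : ℝ) / 2) *
      ((min (t : ℝ) u * |(t : ℝ) - u|) ^ (-(H * d / 2)) *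
        (min (s : ℝ) v * |(s : ℝ) - v|) ^ (-(H * d / 2))) := by
  have hk := two_sub_two_rpow_pos hH1
  have h0 : (t : ℝ) - u ≠ 0 := sub_ne_zero.2 (by exact_mod_cast htu)
  have h0' : (s : ℝ) - v ≠ 0 := sub_ne_zero.2 (by exact_mod_cast hsv)
  have h1 : 0 < (min (t : ℝ) u * |(t : ℝ) - u|) := mul_pos (lt_min ht hu) (abs_pos.2 h0)
  have h2 : 0 < (min (s : ℝ) v * |(s : ℝ) - v|) := mul_pos (lt_min hs hv) (abs_pos.2 h0')
  have h := fbmDiffDet_ge hH0 hH1 t s u v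
  set x := (min (t : ℝ) u * |(t : ℝ) - u|)
  set y := (min (s : ℝ) v * |(s : ℝ) - v|)
  have hxy : x ^ H * y ^ H ≤ x ^ (2 * H) + y ^ (2 * H) := by
    rw [rpow_two_mul_eq_sq h1.le, rpow_two_mul_eq_sq h2.le]
    have hx : 0 ≤ x ^ H := by positivity
    have hy : 0 ≤ y ^ H := by positivity
    nlinarith [sq_nonneg (x ^ H - y ^ H), mul_nonneg hx hy]
  have h3 : (2 - 2 ^ H) / 4 * (x ^ H * y ^ H) ≤ fbmDiffDet H t s u v :=
    (mul_le_mul_of_nonneg_left hxy (by positivity)).trans h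
  refine (Real.rpow_le_rpow_of_nonpos (by positivity) h3 ?_).trans_eq ?_
  · rw [neg_div]; exact neg_nonpos.2 (by positivity)
  rw [Real.mul_rpow (by positivity) (by positivity), Real.mul_rpow (by positivity) (by positivity),
    ← Real.rpow_mul h1.le, ← Real.rpow_mul h2.le, show H * (-(d : ℝ) / 2) = -(H * d / 2) by ring]

end LocalNondeterminism

/-! ### Nonintegrability from scaling -/

section Scaling

/-- A function on a set contracted by `x ↦ x / 2` that blows up at least like the inverse of the
Jacobian of this contraction is not integrable. -/
lemma setLIntegral_eq_top_of_two_pow_mul_le {E : Type*} [NormedAddCommGroup E] [NormedSpace ℝ E]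
    [FiniteDimensional ℝ E] [MeasurableSpace E] [BorelSpace E] [Nontrivial E] (μ : Measure E)
    [μ.IsAddHaarMeasure] {S : Set E} (hS : MeasurableSet S)
    (hhalf : ∀ x ∈ S, (1 / 2 : ℝ) • x ∈ S) (hS0 : μ S ≠ 0) (hStop : μ S ≠ ∞)
    {f : E → ℝ≥0∞} (hf : AEMeasurable f (μ.restrict S))
    (hscale : ∀ x ∈ S, 2 ^ Module.finrank ℝ E * f x ≤ f ((1 / 2 : ℝ) • x))
    (hpos : ∀ᵐ x ∂μ.restrict S, f x ≠ 0) : ∫⁻ x in S, f x ∂μ = ∞ := by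
  by_contra hfin
  set n := Module.finrank ℝ E
  have hn : n ≠ 0 := Module.finrank_pos.ne'
  let S' : Set E := (fun x => (2 : ℝ) • x) ⁻¹' S
  have hS'm : MeasurableSet S' := (measurable_const_smul (2 : ℝ)) hS
  have hS'S : S' ⊆ S := fun x hx => by simpa [smul_smul] using hhalf _ hx
  have hpre : (fun x => (1 / 2 : ℝ) • x) ⁻¹' S' = S := by ext x; simp [S', smul_smul]
  have hmap : Measure.map ((1 / 2 : ℝ) • ·) μ = (2 : ℝ≥0∞) ^ n • μ := by
    rw [Measure.map_addHaar_smul μ (by norm_num)]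
    congr 1
    rw [one_div, inv_pow, inv_inv, abs_of_pos (by positivity), ENNReal.ofReal_pow (by norm_num),
      ENNReal.ofReal_ofNat]
  have hemb : MeasurableEmbedding (fun x : E => (1 / 2 : ℝ) • x) :=
    measurableEmbedding_const_smul₀ (by norm_num)
  have hchange : 2 ^ n * ∫⁻ x in S', f x ∂μ = ∫⁻ x in S, f ((1 / 2 : ℝ) • x) ∂μ := by
    have h := hemb.restrict_map μ S'
    rw [hpre, hmap, Measure.restrict_smul] at h
    rw [← hemb.lintegral_map, ← h, lintegral_smul_measure, smul_eq_mul]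
  -- `S'` is the half-size copy of `S`. The growth of `f` under halving compensates the Jacobian, so
  -- this copy carries at least the whole integral.
  have hle : ∫⁻ x in S, f x ∂μ ≤ ∫⁻ x in S', f x ∂μ := by
    have h : 2 ^ n * ∫⁻ x in S, f x ∂μ ≤ 2 ^ n * ∫⁻ x in S', f x ∂μ := by
      rw [hchange, ← lintegral_const_mul'' _ hf]
      exact setLIntegral_mono' hS hscale
    rwa [ENNReal.mul_le_mul_iff_right (by positivity) (by finiteness)] at h
  have hsplit := lintegral_inter_add_sdiff f S (μ := μ) hS'm
  rw [Set.inter_eq_right.2 hS'S] at hsplit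
  have hS'fin : ∫⁻ x in S', f x ∂μ ≠ ∞ :=
    ne_top_of_le_ne_top hfin (lintegral_mono_set hS'S)
  -- A finite integral leaves no mass on `S \ S'`. As `f` is almost everywhere nonzero, this set
  -- would be null, contradicting `μ S' = 2⁻ⁿ μ S < μ S`.
  have hdiff : ∫⁻ x in S \ S', f x ∂μ = 0 := by
    by_contra h0
    exact (ENNReal.lt_add_right hS'fin h0).not_ge (hsplit.trans_le hle)
  rw [lintegral_eq_zero_iff' (hf.mono_measure (Measure.restrict_mono_set _ Set.sdiff_subset))]
    at hdiff
  have hnull : ∀ᵐ x ∂μ.restrict (S \ S'), False := by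
    filter_upwards [hdiff, ae_mono (Measure.restrict_mono_set μ Set.sdiff_subset) hpos] with x h1 h2
    exact h2 h1
  rw [eventually_false_iff_eq_bot, ae_eq_bot, Measure.restrict_eq_zero,
    measure_sdiff hS'S hS'm.nullMeasurableSet (measure_ne_top_of_subset hS'S hStop)] at hnull
  rw [Measure.addHaar_preimage_smul μ two_ne_zero, tsub_eq_zero_iff_le] at hnull
  refine hnull.not_gt ?_
  conv_rhs => rw [← one_mul (μ S)]
  refine ENNReal.mul_lt_mul_left hS0 hStop ?_
  rw [← ENNReal.ofReal_one, ENNReal.ofReal_lt_ofReal_iff one_pos, abs_of_pos (by positivity)]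
  exact inv_lt_one_of_one_lt₀ (one_lt_pow₀ one_lt_two hn)

end Scaling

/-! ### Divergence of integrals by Fatou's lemma -/

section Fatou

lemma tendsto_integral_atTop_of_lintegral_eq_top {α : Type*} [MeasurableSpace α] {μ : Measure α}
    {F : ℝ → α → ℝ} {f : α → ℝ} (hm : ∀ ε, AEMeasurable (F ε) μ)
    (hF : ∀ ε, 0 < ε → Integrable (F ε) μ) (hF0 : ∀ ε, 0 < ε → 0 ≤ᵐ[μ] F ε)
    (hlim : ∀ᵐ x ∂μ, Tendsto (fun ε => F ε x) (𝓝[>] 0) (𝓝 (f x)))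
    (htop : ∫⁻ x, ENNReal.ofReal (f x) ∂μ = ∞) :
    Tendsto (fun ε => ∫ x, F ε x ∂μ) (𝓝[>] 0) atTop := by
  rw [← ENNReal.tendsto_ofReal_nhds_top]
  have h1 : ∀ᶠ ε in 𝓝[>] (0 : ℝ), ∫⁻ x, ENNReal.ofReal (F ε x) ∂μ =
      ENNReal.ofReal (∫ x, F ε x ∂μ) := by
    filter_upwards [self_mem_nhdsWithin] with ε hε
    exact (ofReal_integral_eq_lintegral_ofReal (hF ε hε) (hF0 ε hε)).symm
  refine Tendsto.congr' h1 ?_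
  have h2 : ∫⁻ x, liminf (fun ε => ENNReal.ofReal (F ε x)) (𝓝[>] 0) ∂μ = ∞ := by
    rw [← htop]
    refine lintegral_congr_ae ?_
    filter_upwards [hlim] with x hx
    exact (ENNReal.tendsto_ofReal hx).liminf_eq
  have h3 := lintegral_liminf_le' (μ := μ) (u := 𝓝[>] (0 : ℝ))
    (f := fun ε x => ENNReal.ofReal (F ε x)) (fun ε => (hm ε).ennreal_ofReal)
  rw [h2] at h3
  exact tendsto_of_le_liminf_of_limsup_le h3 le_top

end Fatou

/-! ### Integrability of the singular kernel in two times -/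

section SingularKernel

lemma setLIntegral_abs_rpow_lt_top {a : ℝ} (ha1 : a < 1) (T : ℝ) :
    ∫⁻ x in Set.Icc (-T) T, ENNReal.ofReal (|x| ^ (-a)) < ∞ := by
  rcases le_total T 0 with hT | hT
  · have h : volume (Set.Icc (-T) T) = 0 := by
      rw [Real.volume_Icc, ENNReal.ofReal_eq_zero]; linarith
    rw [Measure.restrict_eq_zero.2 h, lintegral_zero_measure]
    exact ENNReal.zero_lt_top
  have h0 : IntervalIntegrable (fun x : ℝ => x ^ (-a)) volume 0 T :=
    intervalIntegral.intervalIntegrable_rpow' (by linarith)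
  have h1 : IntervalIntegrable (fun x : ℝ => |x| ^ (-a)) volume 0 T := by
    refine h0.congr fun x hx => ?_
    rw [Set.uIoc_of_le hT] at hx
    rw [abs_of_pos hx.1]
  have h2 : IntervalIntegrable (fun x : ℝ => |x| ^ (-a)) volume (-T) 0 := by
    rw [IntervalIntegrable.iff_comp_neg]
    simpa using h1.symm
  have h3 := (h2.trans h1)
  rw [intervalIntegrable_iff_integrableOn_Icc_of_le (by linarith)] at h3
  exact h3.lintegral_lt_top

lemma measurable_min_mul_abs_sub_rpow (a : ℝ) :
    Measurable fun p : ℝ × ℝ => ENNReal.ofReal ((min p.1 p.2 * |p.1 - p.2|) ^ (-a)) := by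
  fun_prop

/-- The minimum is one of the two times, so the kernel is at most `(t^{-a} + u^{-a})|t-u|^{-a}`. The
two terms have equal integrals by symmetry, and integrating the difference first gives a bound
uniform in the remaining time. -/
lemma lintegral_min_mul_abs_sub_rpow_lt_top {a : ℝ} (ha1 : a < 1) (T : ℝ) :
    ∫⁻ p, ENNReal.ofReal ((min p.1 p.2 * |p.1 - p.2|) ^ (-a))
      ∂((volume.restrict (Set.Ioc 0 T)).prod (volume.restrict (Set.Ioc 0 T))) < ∞ := by
  let k : ℝ → ℝ≥0∞ := fun x => ENNReal.ofReal (|x| ^ (-a))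
  have hkm : Measurable k := by fun_prop
  let C := ∫⁻ x in Set.Icc (-T) T, k x
  have hC : C < ∞ := setLIntegral_abs_rpow_lt_top ha1 T
  have hconv : ∀ t ∈ Set.Ioc 0 T, ∫⁻ u in Set.Ioc 0 T, k (t - u) ≤ C := fun t ht => by
    rw [← lintegral_indicator measurableSet_Ioc]
    calc _ ≤ ∫⁻ u, (Set.Icc (-T) T).indicator k (t - u) := by
          refine lintegral_mono fun u => ?_
          by_cases hu : u ∈ Set.Ioc 0 T
          · rw [Set.indicator_of_mem hu, Set.indicator_of_mem]
            exact ⟨by linarith [hu.2, ht.1], by linarith [hu.1, ht.2]⟩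
          · rw [Set.indicator_of_notMem hu]; exact zero_le
      _ = C := by
          rw [lintegral_sub_left_eq_self (fun x => (Set.Icc (-T) T).indicator k x) t,
            lintegral_indicator measurableSet_Icc]
  have hA : ∫⁻ t in Set.Ioc 0 T, ∫⁻ u in Set.Ioc 0 T, k t * k (t - u) < ∞ := by
    calc _ ≤ ∫⁻ t in Set.Ioc 0 T, k t * C := by
          refine setLIntegral_mono' measurableSet_Ioc fun t ht => ?_
          rw [lintegral_const_mul _ (by fun_prop)]
          exact mul_le_mul_right (hconv t ht) _
      _ ≤ C * C := by
          rw [lintegral_mul_const _ hkm]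
          refine mul_le_mul_left (lintegral_mono_set fun x hx => ?_) _
          exact ⟨by linarith [hx.1, hx.2], hx.2⟩
      _ < ∞ := by finiteness
  have hswap : ∫⁻ t in Set.Ioc 0 T, ∫⁻ u in Set.Ioc 0 T, k u * k (t - u) =
      ∫⁻ t in Set.Ioc 0 T, ∫⁻ u in Set.Ioc 0 T, k t * k (t - u) := by
    rw [lintegral_lintegral_swap (by simp only [Function.uncurry_def]; fun_prop)]
    simp only [k, abs_sub_comm]
  rw [lintegral_prod _ (measurable_min_mul_abs_sub_rpow a).aemeasurable]
  calc _ ≤ ∫⁻ t in Set.Ioc 0 T, ((∫⁻ u in Set.Ioc 0 T, k t * k (t - u)) +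
        ∫⁻ u in Set.Ioc 0 T, k u * k (t - u)) := by
        refine setLIntegral_mono' measurableSet_Ioc fun t ht => ?_
        rw [← lintegral_add_left (by fun_prop)]
        refine setLIntegral_mono' measurableSet_Ioc fun u hu => ?_
        simp only [k]
        rw [Real.mul_rpow (le_min ht.1.le hu.1.le) (abs_nonneg _),
          ENNReal.ofReal_mul (Real.rpow_nonneg (le_min ht.1.le hu.1.le) _),
          abs_of_pos ht.1, abs_of_pos hu.1]
        rcases min_choice t u with h | h <;> rw [h]
        · exact le_self_add
        · exact le_add_self
    _ < ∞ := by
        rw [lintegral_add_left (by fun_prop), hswap]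
        finiteness

end SingularKernel

/-! ### Fubini for bounded parametric integrals -/

section ParametricIntegral

variable {Ω Z : Type*} [MeasurableSpace Ω] [MeasurableSpace Z] {P : Measure Ω} {m : Measure Z}
  [IsFiniteMeasure P] [IsFiniteMeasure m] {G G' : Ω → Z → ℝ} {C C' : ℝ}

lemma integrable_uncurry_of_bound
    (hG : AEStronglyMeasurable (Function.uncurry G) (P.prod m)) (hC : ∀ ω z, ‖G ω z‖ ≤ C) :
    Integrable (Function.uncurry G) (P.prod m) :=
  Integrable.of_bound hG C (ae_of_all _ fun p => hC p.1 p.2)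

lemma memLp_two_integral_of_bound
    (hG : AEStronglyMeasurable (Function.uncurry G) (P.prod m)) (hC : ∀ ω z, ‖G ω z‖ ≤ C) :
    MemLp (fun ω => ∫ z, G ω z ∂m) 2 P :=
  MemLp.of_bound hG.integral_prod_right' (C * m.real Set.univ)
    (ae_of_all _ fun ω => norm_integral_le_of_norm_le_const (ae_of_all _ fun z => hC ω z))

lemma integral_integral_mul_integral_of_bound
    (hG : AEStronglyMeasurable (Function.uncurry G) (P.prod m)) (hC : ∀ ω z, ‖G ω z‖ ≤ C)
    (hG' : AEStronglyMeasurable (Function.uncurry G') (P.prod m)) (hC' : ∀ ω z, ‖G' ω z‖ ≤ C') :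
    ∫ ω, (∫ z, G ω z ∂m) * (∫ z, G' ω z ∂m) ∂P =
      ∫ p : Z × Z, ∫ ω, G ω p.1 * G' ω p.2 ∂P ∂(m.prod m) := by
  simp_rw [← integral_prod_mul]
  refine integral_integral_swap ?_
  have h1 : Measure.QuasiMeasurePreserving (fun q : Ω × (Z × Z) => (q.1, q.2.1))
      (P.prod (m.prod m)) (P.prod m) :=
    QuasiMeasurePreserving.prodMap (.id P) Measure.quasiMeasurePreserving_fst
  have h2 : Measure.QuasiMeasurePreserving (fun q : Ω × (Z × Z) => (q.1, q.2.2))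
      (P.prod (m.prod m)) (P.prod m) :=
    QuasiMeasurePreserving.prodMap (.id P) Measure.quasiMeasurePreserving_snd
  refine Integrable.of_bound ((hG.comp_quasiMeasurePreserving h1).mul
    (hG'.comp_quasiMeasurePreserving h2)) (C * C') (ae_of_all _ fun q => ?_)
  change ‖G q.1 q.2.1 * G' q.1 q.2.2‖ ≤ C * C'
  rw [norm_mul]
  exact mul_le_mul (hC _ _) (hC' _ _) (norm_nonneg _) ((norm_nonneg _).trans (hC q.1 q.2.1))

end ParametricIntegral

/-! ### Criteria for and against convergence in L² -/

section ConvergesInL2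

variable {Ω : Type*} [MeasurableSpace Ω] {P : Measure Ω} {I : ℝ → Ω → ℝ}

/-- Expanding `‖I_ε - I_η‖²` gives three inner products with limits `K`, `2K` and `K`, which cancel;
completeness of `L²` supplies the limit. -/
lemma convergesInL2_of_tendsto_integral_mul (hI : ∀ ε, 0 < ε → MemLp (I ε) 2 P) {K : ℝ}
    (hK : Tendsto (fun p : ℝ × ℝ => ∫ ω, I p.1 ω * I p.2 ω ∂P) (𝓝[>] 0 ×ˢ 𝓝[>] 0) (𝓝 K)) :
    ConvergesInL2 I P := by
  refine ⟨hI, ?_⟩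
  -- The value `0` for `ε ≤ 0` only serves to have an `L²` class for every real parameter.
  let I' : ℝ → Ω → ℝ := fun ε => if 0 < ε then I ε else 0
  have hI' : ∀ ε, MemLp (I' ε) 2 P := fun ε => by
    by_cases h : 0 < ε
    · simpa [I', h] using hI ε h
    · simp [I', h]
  let J : ℝ → Lp ℝ 2 P := fun ε => (hI' ε).toLp (I' ε)
  have hinner : ∀ ε η, 0 < ε → 0 < η → inner ℝ (J ε) (J η) = ∫ ω, I ε ω * I η ω ∂P := by
    intro ε η hε hη
    rw [L2.inner_def]
    refine integral_congr_ae ?_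
    filter_upwards [(hI' ε).coeFn_toLp, (hI' η).coeFn_toLp] with ω h1 h2
    simp only [J]
    rw [h1, h2]
    simp [I', hε, hη, mul_comm]
  have hpos : ∀ᶠ p : ℝ × ℝ in 𝓝[>] 0 ×ˢ 𝓝[>] 0, 0 < p.1 ∧ 0 < p.2 :=
    (eventually_mem_nhdsWithin (a := (0 : ℝ)) (s := Set.Ioi 0)).prod_mk
      (eventually_mem_nhdsWithin (a := (0 : ℝ)) (s := Set.Ioi 0))
  have hdist : Tendsto (fun p : ℝ × ℝ => dist (J p.1) (J p.2)) (𝓝[>] 0 ×ˢ 𝓝[>] 0) (𝓝 0) := by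
    have hdiag : ∀ {g : ℝ × ℝ → ℝ}, Tendsto g (𝓝[>] 0 ×ˢ 𝓝[>] 0) (𝓝[>] 0) →
        Tendsto (fun p => ∫ ω, I (g p) ω * I (g p) ω ∂P) (𝓝[>] 0 ×ˢ 𝓝[>] 0) (𝓝 K) :=
      fun hg => hK.comp (hg.prodMk hg)
    have hsq : Tendsto (fun p : ℝ × ℝ => dist (J p.1) (J p.2) ^ 2) (𝓝[>] 0 ×ˢ 𝓝[>] 0) (𝓝 0) := by
      have h := ((hdiag tendsto_fst).sub (hK.const_mul 2)).add (hdiag tendsto_snd)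
      rw [show K - 2 * K + K = 0 by ring] at h
      refine h.congr' ?_
      filter_upwards [hpos] with p hp
      rw [dist_eq_norm, norm_sub_sq_real, ← real_inner_self_eq_norm_sq,
        ← real_inner_self_eq_norm_sq, hinner _ _ hp.1 hp.1, hinner _ _ hp.1 hp.2,
        hinner _ _ hp.2 hp.2]
    have h := hsq.sqrt
    simpa [Real.sqrt_sq dist_nonneg] using h
  obtain ⟨L, hL⟩ := cauchy_map_iff_exists_tendsto.1
    ((cauchy_map_iff' (f := J)).2 (tendsto_uniformity_iff_dist_tendsto_zero.2 hdist))
  refine ⟨L, Lp.memLp L, ?_⟩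
  have h := (Lp.tendsto_Lp_iff_tendsto_eLpNorm'' I' hI' L (Lp.memLp L)).1 (by
    rw [Lp.toLp_coeFn]; exact hL)
  refine h.congr' ?_
  filter_upwards [self_mem_nhdsWithin] with ε hε
  rw [Set.mem_Ioi] at hε
  simp [I', hε]

/-- On a probability space, `L²` convergence implies `L¹` convergence, so the means have a finite
limit. -/
lemma ConvergesInL2.not_tendsto_integral_atTop [IsProbabilityMeasure P] (h : ConvergesInL2 I P) :
    ¬ Tendsto (fun ε => ∫ ω, I ε ω ∂P) (𝓝[>] 0) atTop := by
  obtain ⟨hI, L, hL, hlim⟩ := h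
  have h1 : Tendsto (fun ε => eLpNorm (I ε - L) 1 P) (𝓝[>] 0) (𝓝 0) := by
    refine tendsto_of_tendsto_of_tendsto_of_le_of_le' tendsto_const_nhds hlim
      (Eventually.of_forall fun _ => zero_le) ?_
    filter_upwards [self_mem_nhdsWithin] with ε hε
    exact eLpNorm_le_eLpNorm_of_exponent_le one_le_two ((hI ε hε).sub hL).aestronglyMeasurable
  have h2 := tendsto_integral_of_L1' L (hL.integrable one_le_two).aestronglyMeasurable
    (by filter_upwards [self_mem_nhdsWithin] with ε hε using (hI ε hε).integrable one_le_two) h1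
  exact not_tendsto_atTop_of_tendsto_nhds h2

end ConvergesInL2

/-! ### Pairs and quadruples of times -/

section TimeBox

/-- Lebesgue measure on `(0, T] × (0, T]`. -/
noncomputable def timeBox (T : ℝ) : Measure (ℝ × ℝ) :=
  (volume.restrict (Set.Ioc 0 T)).prod (volume.restrict (Set.Ioc 0 T))

instance (T : ℝ) : IsFiniteMeasure (timeBox T) := by unfold timeBox; infer_instance

lemma timeBox_eq_restrict (T : ℝ) :
    timeBox T = volume.restrict (Set.Ioc 0 T ×ˢ Set.Ioc 0 T) := by
  rw [timeBox, Measure.prod_restrict, Measure.volume_eq_prod]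

lemma timeBox_prod_eq_restrict (T : ℝ) : (timeBox T).prod (timeBox T) =
    volume.restrict ((Set.Ioc 0 T ×ˢ Set.Ioc 0 T) ×ˢ (Set.Ioc 0 T ×ˢ Set.Ioc 0 T)) := by
  rw [timeBox_eq_restrict, Measure.prod_restrict, ← Measure.volume_eq_prod]

lemma ae_timeBox_pos (T : ℝ) : ∀ᵐ z ∂timeBox T, 0 < z.1 ∧ 0 < z.2 := by
  rw [timeBox_eq_restrict]
  filter_upwards [ae_restrict_mem (measurableSet_Ioc.prod measurableSet_Ioc)] with z hz
  exact ⟨hz.1.1, hz.2.1⟩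

lemma ae_timeBox_ne (T : ℝ) : ∀ᵐ z ∂timeBox T, z.1 ≠ z.2 := by
  have hm : MeasurableSet {z : ℝ × ℝ | z.1 ≠ z.2} :=
    (measurableSet_eq_fun measurable_fst measurable_snd).compl
  refine (Measure.ae_prod_iff_ae_ae hm).2 (ae_of_all _ fun t => ?_)
  filter_upwards [compl_mem_ae_iff.2 (measure_singleton t)] with u hu h
  exact hu h.symm

lemma quasiMeasurePreserving_timeBox_fst (T : ℝ) : Measure.QuasiMeasurePreserving
    (fun p : (ℝ × ℝ) × (ℝ × ℝ) => (p.1.1, p.2.1)) ((timeBox T).prod (timeBox T)) (timeBox T) :=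
  QuasiMeasurePreserving.prodMap Measure.quasiMeasurePreserving_fst
    Measure.quasiMeasurePreserving_fst

lemma quasiMeasurePreserving_timeBox_snd (T : ℝ) : Measure.QuasiMeasurePreserving
    (fun p : (ℝ × ℝ) × (ℝ × ℝ) => (p.1.2, p.2.2)) ((timeBox T).prod (timeBox T)) (timeBox T) :=
  QuasiMeasurePreserving.prodMap Measure.quasiMeasurePreserving_snd
    Measure.quasiMeasurePreserving_snd

/-- The property of quadruples of times to be positive and pairwise distinct for each process. -/
def IsGenericTimes (p : (ℝ × ℝ) × (ℝ × ℝ)) : Prop :=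
  0 < p.1.1 ∧ 0 < p.2.1 ∧ 0 < p.1.2 ∧ 0 < p.2.2 ∧ p.1.1 ≠ p.2.1 ∧ p.1.2 ≠ p.2.2

lemma ae_isGenericTimes (T : ℝ) :
    ∀ᵐ p ∂((timeBox T).prod (timeBox T)), IsGenericTimes p := by
  filter_upwards [(quasiMeasurePreserving_timeBox_fst T).ae (ae_timeBox_pos T),
    (quasiMeasurePreserving_timeBox_snd T).ae (ae_timeBox_pos T),
    (quasiMeasurePreserving_timeBox_fst T).ae (ae_timeBox_ne T),
    (quasiMeasurePreserving_timeBox_snd T).ae (ae_timeBox_ne T)] with p h1 h2 h3 h4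
  exact ⟨h1.1, h1.2, h2.1, h2.2, h3, h4⟩

/-- The measure groups the times as `(t, s)`, `(u, v)`, the kernel as `(t, u)`, `(s, v)`. After
Tonelli, the integral is the square of the two-time one. -/
lemma integrable_timeBox_prod_of_lt_one {a : ℝ} (ha : a < 1) (T : ℝ) :
    Integrable (fun p : (ℝ × ℝ) × (ℝ × ℝ) =>
      (min p.1.1 p.2.1 * |p.1.1 - p.2.1|) ^ (-a) * (min p.1.2 p.2.2 * |p.1.2 - p.2.2|) ^ (-a))
      ((timeBox T).prod (timeBox T)) := by
  let g : ℝ → ℝ → ℝ≥0∞ := fun t u => ENNReal.ofReal ((min t u * |t - u|) ^ (-a))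
  have hg : Measurable (Function.uncurry g) := measurable_min_mul_abs_sub_rpow a
  have hg1 : ∀ t, Measurable (g t) := fun t => hg.comp measurable_prodMk_left
  refine ⟨Measurable.aestronglyMeasurable (by fun_prop), ?_⟩
  have h : ∫⁻ p, g p.1.1 p.2.1 * g p.1.2 p.2.2 ∂((timeBox T).prod (timeBox T)) < ∞ := by
    have hgg : Measurable fun p : (ℝ × ℝ) × (ℝ × ℝ) => g p.1.1 p.2.1 * g p.1.2 p.2.2 := by
      simp only [g]; fun_prop
    rw [lintegral_prod _ hgg.aemeasurable]
    have hin : ∀ z : ℝ × ℝ, ∫⁻ z', g z.1 z'.1 * g z.2 z'.2 ∂timeBox T =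
        (∫⁻ u in Set.Ioc 0 T, g z.1 u) * ∫⁻ v in Set.Ioc 0 T, g z.2 v := fun z =>
      lintegral_prod_mul (hg1 _).aemeasurable (hg1 _).aemeasurable
    simp_rw [hin]
    have hgm : Measurable fun t => ∫⁻ u in Set.Ioc 0 T, g t u := hg.lintegral_prod_right'
    rw [timeBox, lintegral_prod_mul hgm.aemeasurable hgm.aemeasurable]
    have hlt := lintegral_min_mul_abs_sub_rpow_lt_top ha T
    rw [lintegral_prod _ (measurable_min_mul_abs_sub_rpow a).aemeasurable] at hlt
    exact ENNReal.mul_lt_top hlt hlt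
  refine lt_of_le_of_lt (lintegral_mono_ae ?_) h
  filter_upwards [ae_isGenericTimes T] with p hp
  obtain ⟨h1, h2, h3, h4, -, -⟩ := hp
  have hx : 0 ≤ (min p.1.1 p.2.1 * |p.1.1 - p.2.1|) ^ (-a) :=
    Real.rpow_nonneg (mul_nonneg (le_min h1.le h2.le) (abs_nonneg _)) _
  have hy : 0 ≤ (min p.1.2 p.2.2 * |p.1.2 - p.2.2|) ^ (-a) :=
    Real.rpow_nonneg (mul_nonneg (le_min h3.le h4.le) (abs_nonneg _)) _
  rw [Real.enorm_eq_ofReal (mul_nonneg hx hy), ENNReal.ofReal_mul hx]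

end TimeBox

/-! ### Variances and covariances of the difference process -/

section Covariances

variable {H : ℝ}

/-- Variance of a coordinate of `B_t - B'_s`, for `z = (t, s)`. -/
noncomputable def fbmDiffVar (H : ℝ) (z : ℝ × ℝ) : ℝ :=
  (z.1.toNNReal : ℝ) ^ (2 * H) + (z.2.toNNReal : ℝ) ^ (2 * H)

/-- Covariance of a coordinate of `B_t - B'_s` and of `B_u - B'_v`, for `p = ((t, s), (u, v))`. -/
noncomputable def fbmDiffCov (H : ℝ) (p : (ℝ × ℝ) × (ℝ × ℝ)) : ℝ :=
  fbmCov H p.1.1.toNNReal p.2.1.toNNReal + fbmCov H p.1.2.toNNReal p.2.2.toNNReal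

@[fun_prop]
lemma measurable_fbmDiffVar (H : ℝ) : Measurable (fbmDiffVar H) := by
  unfold fbmDiffVar; fun_prop

@[fun_prop]
lemma measurable_fbmDiffCov (H : ℝ) : Measurable (fbmDiffCov H) := by
  unfold fbmDiffCov fbmCov; fun_prop

lemma fbmDiffVar_nonneg (H : ℝ) (z : ℝ × ℝ) : 0 ≤ fbmDiffVar H z := by
  unfold fbmDiffVar; positivity

lemma fbmDiffVar_pos (H : ℝ) {z : ℝ × ℝ} (hz : 0 < z.1) : 0 < fbmDiffVar H z := by
  have h : (0 : ℝ) < z.1.toNNReal := by simpa using hz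
  unfold fbmDiffVar; positivity

lemma fbmDiffCov_sq_le (hH0 : 0 < H) (hH1 : H < 1) (p : (ℝ × ℝ) × (ℝ × ℝ)) :
    fbmDiffCov H p ^ 2 ≤ fbmDiffVar H p.1 * fbmDiffVar H p.2 :=
  sub_nonneg.1 (fbmDiffDet_nonneg hH0 hH1 _ _ _ _)

lemma fbmDiffCov_pos (hH0 : 0 < H) {p : (ℝ × ℝ) × (ℝ × ℝ)} (hp : IsGenericTimes p) :
    0 < fbmDiffCov H p := by
  obtain ⟨h1, h2, h3, h4, -, -⟩ := hp
  exact add_pos (fbmCov_pos hH0 (by simpa) (by simpa)) (fbmCov_pos hH0 (by simpa) (by simpa))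

lemma fbmDiffVar_mul_sub_sq_pos (hH0 : 0 < H) (hH1 : H < 1) {p : (ℝ × ℝ) × (ℝ × ℝ)}
    (hp : IsGenericTimes p) :
    0 < fbmDiffVar H p.1 * fbmDiffVar H p.2 - fbmDiffCov H p ^ 2 := by
  obtain ⟨h1, h2, -, -, h5, -⟩ := hp
  exact fbmDiffDet_pos hH0 hH1 (by simpa) (by simpa)
    fun h => h5 ((Real.toNNReal_eq_toNNReal_iff h1.le h2.le).1 h)

lemma fbmDiffVar_mul_sub_sq_rpow_le (hH0 : 0 < H) (hH1 : H < 1) {p : (ℝ × ℝ) × (ℝ × ℝ)}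
    (hp : IsGenericTimes p) (d : ℕ) :
    (fbmDiffVar H p.1 * fbmDiffVar H p.2 - fbmDiffCov H p ^ 2) ^ (-(d : ℝ) / 2) ≤
      ((2 - 2 ^ H) / 4) ^ (-(d : ℝ) / 2) *
      ((min p.1.1 p.2.1 * |p.1.1 - p.2.1|) ^ (-(H * d / 2)) *
        (min p.1.2 p.2.2 * |p.1.2 - p.2.2|) ^ (-(H * d / 2))) := by
  obtain ⟨h1, h2, h3, h4, h5, h6⟩ := hp
  have h := fbmDiffDet_rpow_le hH0 hH1 (t := p.1.1.toNNReal) (s := p.1.2.toNNReal)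
    (u := p.2.1.toNNReal) (v := p.2.2.toNNReal) (by simpa) (by simpa) (by simpa) (by simpa)
    (fun h => h5 ((Real.toNNReal_eq_toNNReal_iff h1.le h2.le).1 h))
    (fun h => h6 ((Real.toNNReal_eq_toNNReal_iff h3.le h4.le).1 h)) d
  rw [Real.coe_toNNReal _ h1.le, Real.coe_toNNReal _ h2.le, Real.coe_toNNReal _ h3.le,
    Real.coe_toNNReal _ h4.le] at h
  exact h

/-- Self-similarity at ratio `1/2`, the input of the scaling argument. -/
lemma fbmDiffVar_half_smul (H : ℝ) (z : ℝ × ℝ) :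
    fbmDiffVar H ((1 / 2 : ℝ) • z) = (1 / 2) ^ (2 * H) * fbmDiffVar H z := by
  simp only [fbmDiffVar, Prod.smul_fst, Prod.smul_snd, smul_eq_mul,
    Real.toNNReal_mul (show (0 : ℝ) ≤ 1 / 2 by norm_num), NNReal.coe_mul,
    Real.coe_toNNReal _ (show (0 : ℝ) ≤ 1 / 2 by norm_num)]
  rw [Real.mul_rpow (by norm_num) (by positivity), Real.mul_rpow (by norm_num) (by positivity)]
  ring

lemma fbmCov_half_mul (H : ℝ) (t u : ℝ) :
    fbmCov H ((1 / 2) * t).toNNReal ((1 / 2) * u).toNNReal =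
      (1 / 2) ^ (2 * H) * fbmCov H t.toNNReal u.toNNReal := by
  simp only [fbmCov, Real.toNNReal_mul (show (0 : ℝ) ≤ 1 / 2 by norm_num), NNReal.coe_mul,
    Real.coe_toNNReal _ (show (0 : ℝ) ≤ 1 / 2 by norm_num)]
  rw [← mul_sub, abs_mul, abs_of_pos (show (0 : ℝ) < 1 / 2 by norm_num),
    Real.mul_rpow (by norm_num) (by positivity), Real.mul_rpow (by norm_num) (by positivity),
    Real.mul_rpow (by norm_num) (by positivity)]
  ring

lemma fbmDiffCov_half_smul (H : ℝ) (p : (ℝ × ℝ) × (ℝ × ℝ)) :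
    fbmDiffCov H ((1 / 2 : ℝ) • p) = (1 / 2) ^ (2 * H) * fbmDiffCov H p := by
  simp only [fbmDiffCov, Prod.smul_fst, Prod.smul_snd, smul_eq_mul, fbmCov_half_mul]
  ring

end Covariances

/-! ### First and second moments of the approximated local time -/

section Moments

variable {Ω : Type*} [MeasurableSpace Ω] {P : Measure Ω} {d : ℕ} {H T : ℝ}
  {B B' : ℝ≥0 → Ω → EuclideanSpace ℝ (Fin d)}

/-- The heat kernel evaluated at `B_t - B'_s`, for `z = (t, s)`. -/
noncomputable def heatKernelDiff (B B' : ℝ≥0 → Ω → EuclideanSpace ℝ (Fin d)) (ε : ℝ) (ω : Ω)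
    (z : ℝ × ℝ) : ℝ :=
  heatKernel ε (B z.1.toNNReal ω - B' z.2.toNNReal ω)

omit [MeasurableSpace Ω] in
lemma norm_heatKernelDiff_le {ε : ℝ} (hε : 0 < ε) (ω : Ω) (z : ℝ × ℝ) :
    ‖heatKernelDiff B B' ε ω z‖ ≤ (2 * Real.pi * ε) ^ (-(d : ℝ) / 2) := by
  rw [heatKernelDiff, Real.norm_of_nonneg (heatKernel_nonneg hε.le _)]
  exact heatKernel_le hε.le _

lemma IsJointlyAEMeasurable.restrict_Ioc (hB : IsJointlyAEMeasurable B T P) :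
    AEMeasurable (fun p : ℝ × Ω => B p.1.toNNReal p.2)
      ((volume.restrict (Set.Ioc 0 T)).prod P) := by
  rw [Measure.restrict_congr_set Ioc_ae_eq_Icc]
  exact hB

lemma aestronglyMeasurable_heatKernelDiff [IsProbabilityMeasure P]
    (hB : IsJointlyAEMeasurable B T P) (hB' : IsJointlyAEMeasurable B' T P) (ε : ℝ) :
    AEStronglyMeasurable (Function.uncurry (heatKernelDiff B B' ε)) (P.prod (timeBox T)) := by
  have hfst : Measure.QuasiMeasurePreserving (fun q : Ω × (ℝ × ℝ) => (q.2.1, q.1))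
      (P.prod (timeBox T)) ((volume.restrict (Set.Ioc 0 T)).prod P) :=
    Measure.measurePreserving_swap.quasiMeasurePreserving.comp
      (QuasiMeasurePreserving.prodMap (.id P) Measure.quasiMeasurePreserving_fst)
  have hsnd : Measure.QuasiMeasurePreserving (fun q : Ω × (ℝ × ℝ) => (q.2.2, q.1))
      (P.prod (timeBox T)) ((volume.restrict (Set.Ioc 0 T)).prod P) :=
    Measure.measurePreserving_swap.quasiMeasurePreserving.comp
      (QuasiMeasurePreserving.prodMap (.id P) Measure.quasiMeasurePreserving_snd)
  have h1 := hB.restrict_Ioc.comp_quasiMeasurePreserving hfst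
  have h2 := hB'.restrict_Ioc.comp_quasiMeasurePreserving hsnd
  exact ((continuous_heatKernel ε).measurable.comp_aemeasurable (h1.sub h2)).aestronglyMeasurable

lemma approxILT_ae_eq [IsProbabilityMeasure P] (hT : 0 ≤ T)
    (hB : IsJointlyAEMeasurable B T P) (hB' : IsJointlyAEMeasurable B' T P) {ε : ℝ} (hε : 0 < ε) :
    approxILT B B' T ε =ᵐ[P] fun ω => ∫ z, heatKernelDiff B B' ε ω z ∂timeBox T := by
  filter_upwards [(aestronglyMeasurable_heatKernelDiff hB hB' ε).prodMk_left] with ω hω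
  have hi : Integrable (heatKernelDiff B B' ε ω) (timeBox T) :=
    Integrable.of_bound hω _ (ae_of_all _ fun z => norm_heatKernelDiff_le hε ω z)
  unfold timeBox at hi ⊢
  rw [integral_prod _ hi]
  simp only [approxILT, intervalIntegral.integral_of_le hT, heatKernelDiff]

lemma memLp_approxILT [IsProbabilityMeasure P] (hT : 0 ≤ T)
    (hB : IsJointlyAEMeasurable B T P) (hB' : IsJointlyAEMeasurable B' T P) {ε : ℝ} (hε : 0 < ε) :
    MemLp (approxILT B B' T ε) 2 P :=
  (memLp_two_integral_of_bound (aestronglyMeasurable_heatKernelDiff hB hB' ε)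
    (norm_heatKernelDiff_le hε)).ae_eq (approxILT_ae_eq hT hB hB' hε).symm

variable [IsProbabilityMeasure P] (hH0 : 0 < H)
  (hB : IsFractionalBrownianMotion H B P) (hB' : IsFractionalBrownianMotion H B' P)
  (hindep : IndepFun (fun ω t => B t ω) (fun ω t => B' t ω) P)

include hH0 hB hB' hindep

lemma integral_heatKernelDiff_mul (hH1 : H < 1) {ε η : ℝ} (hε : 0 < ε) (hη : 0 < η) (p : (ℝ × ℝ) × (ℝ × ℝ)) :
    ∫ ω, heatKernelDiff B B' ε ω p.1 * heatKernelDiff B B' η ω p.2 ∂P =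
      (2 * Real.pi) ^ (-(d : ℝ)) *
        ((fbmDiffVar H p.1 + ε) * (fbmDiffVar H p.2 + η) - fbmDiffCov H p ^ 2) ^ (-(d : ℝ) / 2) :=
  integral_heatKernel_mul_heatKernel
    ((hB.aemeasurable _).sub (hB'.aemeasurable _)) ((hB.aemeasurable _).sub (hB'.aemeasurable _))
    (fbmDiffVar_nonneg H p.1) (fbmDiffVar_nonneg H p.2) (fbmDiffCov_sq_le hH0 hH1 p)
    (integral_cexp_inner_sub_add_inner_sub hH0 hB hB' hindep _ _ _ _) hε hη

lemma integral_heatKernelDiff {ε : ℝ} (hε : 0 < ε) (z : ℝ × ℝ) :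
    ∫ ω, heatKernelDiff B B' ε ω z ∂P =
      (2 * Real.pi) ^ (-(d : ℝ) / 2) * (fbmDiffVar H z + ε) ^ (-(d : ℝ) / 2) := by
  refine integral_heatKernel_eq ((hB.aemeasurable _).sub (hB'.aemeasurable _))
    (fbmDiffVar_nonneg H z) (fun ξ => ?_) hε
  -- With the second frequency equal to `0`, the second pair of times plays no role.
  have h := integral_cexp_inner_sub_add_inner_sub hH0 hB hB' hindep
    z.1.toNNReal z.2.toNNReal 0 0 ξ 0
  simpa [fbmDiffVar] using h

variable (hT : 0 ≤ T) (hBm : IsJointlyAEMeasurable B T P) (hBm' : IsJointlyAEMeasurable B' T P)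

include hT hBm hBm'

lemma integral_approxILT {ε : ℝ} (hε : 0 < ε) :
    ∫ ω, approxILT B B' T ε ω ∂P = ∫ z, (2 * Real.pi) ^ (-(d : ℝ) / 2) *
      (fbmDiffVar H z + ε) ^ (-(d : ℝ) / 2) ∂timeBox T := by
  rw [integral_congr_ae (approxILT_ae_eq hT hBm hBm' hε), integral_integral_swap
    (integrable_uncurry_of_bound (aestronglyMeasurable_heatKernelDiff hBm hBm' ε)
      (norm_heatKernelDiff_le hε))]
  simp_rw [integral_heatKernelDiff hH0 hB hB' hindep hε]

lemma integral_approxILT_mul (hH1 : H < 1) {ε η : ℝ} (hε : 0 < ε) (hη : 0 < η) :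
    ∫ ω, approxILT B B' T ε ω * approxILT B B' T η ω ∂P =
      ∫ p, (2 * Real.pi) ^ (-(d : ℝ)) *
        ((fbmDiffVar H p.1 + ε) * (fbmDiffVar H p.2 + η) - fbmDiffCov H p ^ 2) ^ (-(d : ℝ) / 2)
        ∂((timeBox T).prod (timeBox T)) := by
  have h : (fun ω => approxILT B B' T ε ω * approxILT B B' T η ω) =ᵐ[P] fun ω =>
      (∫ z, heatKernelDiff B B' ε ω z ∂timeBox T) * ∫ z, heatKernelDiff B B' η ω z ∂timeBox T :=
    (approxILT_ae_eq hT hBm hBm' hε).mul (approxILT_ae_eq hT hBm hBm' hη)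
  rw [integral_congr_ae h, integral_integral_mul_integral_of_bound
    (aestronglyMeasurable_heatKernelDiff hBm hBm' ε) (norm_heatKernelDiff_le hε)
    (aestronglyMeasurable_heatKernelDiff hBm hBm' η) (norm_heatKernelDiff_le hη)]
  simp_rw [integral_heatKernelDiff_mul hH0 hB hB' hindep hH1 hε hη]

end Moments

/-! ### The variance kernel: sign and scaling -/

section Kernels

variable {H : ℝ} {d : ℕ}

/-- The density of the covariance of the approximated local times, in terms of the times. -/
noncomputable def covKernel (H : ℝ) (d : ℕ) (ε : ℝ) (p : (ℝ × ℝ) × (ℝ × ℝ)) : ℝ :=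
  (2 * Real.pi) ^ (-(d : ℝ)) *
      ((fbmDiffVar H p.1 + ε) * (fbmDiffVar H p.2 + ε) - fbmDiffCov H p ^ 2) ^ (-(d : ℝ) / 2) -
    ((2 * Real.pi) ^ (-(d : ℝ) / 2) * (fbmDiffVar H p.1 + ε) ^ (-(d : ℝ) / 2)) *
      ((2 * Real.pi) ^ (-(d : ℝ) / 2) * (fbmDiffVar H p.2 + ε) ^ (-(d : ℝ) / 2))

/-- In this form the kernel compares one decreasing power at the determinant and at the product of
the variances. Its sign and its homogeneity can both be read off. -/
lemma covKernel_eq {ε : ℝ} (hε : 0 ≤ ε) (p : (ℝ × ℝ) × (ℝ × ℝ)) :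
    covKernel H d ε p = (2 * Real.pi) ^ (-(d : ℝ)) *
      (((fbmDiffVar H p.1 + ε) * (fbmDiffVar H p.2 + ε) - fbmDiffCov H p ^ 2) ^ (-(d : ℝ) / 2) -
        ((fbmDiffVar H p.1 + ε) * (fbmDiffVar H p.2 + ε)) ^ (-(d : ℝ) / 2)) := by
  have h1 := fbmDiffVar_nonneg H p.1
  have h2 := fbmDiffVar_nonneg H p.2
  have hpi := Real.pi_pos
  have h3 : (2 * Real.pi) ^ (-(d : ℝ)) =
      (2 * Real.pi) ^ (-(d : ℝ) / 2) * (2 * Real.pi) ^ (-(d : ℝ) / 2) := by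
    rw [← Real.rpow_add (by positivity)]; congr 1; ring
  rw [Real.mul_rpow (x := fbmDiffVar H p.1 + ε) (by positivity) (by positivity), mul_sub, h3,
    covKernel, h3]
  ring

lemma measurable_covKernel (H : ℝ) (d : ℕ) (ε : ℝ) : Measurable (covKernel H d ε) := by
  unfold covKernel; fun_prop

lemma sq_le_add_mul_add_sub (hH0 : 0 < H) (hH1 : H < 1) {ε : ℝ} (hε : 0 < ε)
    (p : (ℝ × ℝ) × (ℝ × ℝ)) :
    ε ^ 2 ≤ (fbmDiffVar H p.1 + ε) * (fbmDiffVar H p.2 + ε) - fbmDiffCov H p ^ 2 := by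
  have h1 := fbmDiffVar_nonneg H p.1
  have h2 := fbmDiffVar_nonneg H p.2
  nlinarith [fbmDiffCov_sq_le hH0 hH1 p, mul_nonneg h1 hε.le, mul_nonneg h2 hε.le]

lemma neg_natCast_div_two_nonpos (d : ℕ) : -(d : ℝ) / 2 ≤ 0 := by
  rw [neg_div]; exact neg_nonpos.2 (by positivity)

lemma covKernel_nonneg (hH0 : 0 < H) (hH1 : H < 1) {ε : ℝ} (hε : 0 < ε)
    (p : (ℝ × ℝ) × (ℝ × ℝ)) : 0 ≤ covKernel H d ε p := by
  rw [covKernel_eq hε.le]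
  have h := sq_le_add_mul_add_sub hH0 hH1 hε p
  refine mul_nonneg (by positivity) (sub_nonneg.2 ?_)
  exact Real.rpow_le_rpow_of_nonpos ((by positivity : 0 < ε ^ 2).trans_le h)
    (by linarith [sq_nonneg (fbmDiffCov H p)]) (neg_natCast_div_two_nonpos d)

lemma covKernel_zero_pos (hH0 : 0 < H) (hH1 : H < 1) (hd : 0 < d) {p : (ℝ × ℝ) × (ℝ × ℝ)}
    (hp : IsGenericTimes p) : 0 < covKernel H d 0 p := by
  rw [covKernel_eq le_rfl]
  simp only [add_zero]
  have h := fbmDiffVar_mul_sub_sq_pos hH0 hH1 hp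
  have hpi := Real.pi_pos
  have hc := fbmDiffCov_pos hH0 hp
  refine mul_pos (by positivity) (sub_pos.2 ?_)
  refine Real.rpow_lt_rpow_of_neg h (by linarith [sq_pos_of_pos hc]) ?_
  rw [neg_div]; exact neg_neg_of_pos (by positivity)

/-- The right-hand side is `2^{Hd}`. The exponent `2` is the dimension of the pairs of times; the
square of the inequality serves the quadruples. -/
lemma four_le_inv_two_rpow_rpow (hHd : 2 ≤ H * d) :
    (2 : ℝ) ^ 2 ≤ (((1 / 2 : ℝ) ^ (2 * H)) ^ (-(d : ℝ) / 2)) := by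
  rw [← Real.rpow_mul (by norm_num), one_div, Real.inv_rpow (by norm_num),
    ← Real.rpow_neg (by norm_num), ← Real.rpow_natCast]
  exact Real.rpow_le_rpow_of_exponent_le (by norm_num) (by push_cast; linarith)

lemma covKernel_half_smul_ge (hH0 : 0 < H) (hH1 : H < 1) (hHd : 2 ≤ H * d)
    {p : (ℝ × ℝ) × (ℝ × ℝ)} (hp : 0 ≤ covKernel H d 0 p) :
    2 ^ 4 * covKernel H d 0 p ≤ covKernel H d 0 ((1 / 2 : ℝ) • p) := by
  have h4 := four_le_inv_two_rpow_rpow hHd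
  have hc : 0 ≤ (1 / 2 : ℝ) ^ (2 * H) := by positivity
  have h : covKernel H d 0 ((1 / 2 : ℝ) • p) =
      (((1 / 2 : ℝ) ^ (2 * H)) ^ (-(d : ℝ) / 2)) ^ 2 * covKernel H d 0 p := by
    rw [covKernel_eq le_rfl, covKernel_eq le_rfl]
    simp only [add_zero, Prod.smul_fst, Prod.smul_snd, fbmDiffVar_half_smul, fbmDiffCov_half_smul]
    set c := (1 / 2 : ℝ) ^ (2 * H)
    have h1 := fbmDiffVar_nonneg H p.1
    have h2 := fbmDiffVar_nonneg H p.2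
    have h3 := sub_nonneg.2 (fbmDiffCov_sq_le hH0 hH1 p)
    rw [show c * fbmDiffVar H p.1 * (c * fbmDiffVar H p.2) =
        (c * c) * (fbmDiffVar H p.1 * fbmDiffVar H p.2) by ring, mul_pow, sq c, ← mul_sub,
      Real.mul_rpow (by positivity) h3, Real.mul_rpow (x := c * c) (by positivity) (by positivity),
      Real.mul_rpow hc hc]
    ring
  rw [h]
  refine mul_le_mul_of_nonneg_right ?_ hp
  nlinarith

end Kernels

/-! ### Divergence of mean and variance when Hd ≥ 2 -/

section Divergence

variable {H T : ℝ} {d : ℕ}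

lemma measurableSet_timeSquare (T : ℝ) : MeasurableSet (Set.Ioc 0 T ×ˢ Set.Ioc 0 T) :=
  measurableSet_Ioc.prod measurableSet_Ioc

lemma half_mul_mem_Ioc {x : ℝ} (hx : x ∈ Set.Ioc 0 T) : 1 / 2 * x ∈ Set.Ioc 0 T :=
  ⟨by linarith [hx.1], by linarith [hx.1, hx.2]⟩

lemma volume_timeSquare (T : ℝ) :
    volume (Set.Ioc 0 T ×ˢ Set.Ioc 0 T) = ENNReal.ofReal T * ENNReal.ofReal T := by
  rw [Measure.volume_eq_prod, Measure.prod_prod, Real.volume_Ioc, sub_zero]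

lemma lintegral_fbmDiffVar_rpow_eq_top (hT : 0 < T) (hHd : 2 ≤ H * d) :
    ∫⁻ z, ENNReal.ofReal ((2 * Real.pi) ^ (-(d : ℝ) / 2) * fbmDiffVar H z ^ (-(d : ℝ) / 2))
      ∂timeBox T = ∞ := by
  have hpi := Real.pi_pos
  have hT' : ENNReal.ofReal T ≠ 0 := by simpa using hT
  have hpos := ae_timeBox_pos T
  rw [timeBox_eq_restrict] at hpos ⊢
  refine setLIntegral_eq_top_of_two_pow_mul_le volume (measurableSet_timeSquare T)
    (fun x hx => ⟨half_mul_mem_Ioc hx.1, half_mul_mem_Ioc hx.2⟩) ?_ ?_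
    (Measurable.aemeasurable (by fun_prop)) (fun z _ => ?_) ?_
  · rw [volume_timeSquare]; exact mul_ne_zero hT' hT'
  · rw [volume_timeSquare]; finiteness
  · rw [show Module.finrank ℝ (ℝ × ℝ) = 2 by simp, ← ENNReal.ofReal_ofNat,
      ← ENNReal.ofReal_pow (by norm_num), ← ENNReal.ofReal_mul (by norm_num),
      fbmDiffVar_half_smul, Real.mul_rpow (by positivity) (fbmDiffVar_nonneg H z), mul_left_comm]
    refine ENNReal.ofReal_le_ofReal (mul_le_mul_of_nonneg_left ?_ (by positivity))
    exact mul_le_mul_of_nonneg_right (four_le_inv_two_rpow_rpow hHd)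
      (Real.rpow_nonneg (fbmDiffVar_nonneg H z) _)
  · filter_upwards [hpos] with z hz
    have h := fbmDiffVar_pos H hz.1
    rw [ne_eq, ENNReal.ofReal_eq_zero, not_le]
    positivity

lemma lintegral_covKernel_eq_top (hH0 : 0 < H) (hH1 : H < 1) (hd : 0 < d) (hT : 0 < T)
    (hHd : 2 ≤ H * d) :
    ∫⁻ p, ENNReal.ofReal (covKernel H d 0 p) ∂((timeBox T).prod (timeBox T)) = ∞ := by
  have hT' : ENNReal.ofReal T ≠ 0 := by simpa using hT
  have hgen := ae_isGenericTimes T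
  rw [timeBox_prod_eq_restrict] at hgen ⊢
  have hvol : volume ((Set.Ioc 0 T ×ˢ Set.Ioc 0 T) ×ˢ (Set.Ioc 0 T ×ˢ Set.Ioc 0 T)) =
      ENNReal.ofReal T * ENNReal.ofReal T * (ENNReal.ofReal T * ENNReal.ofReal T) := by
    rw [Measure.volume_eq_prod, Measure.prod_prod, volume_timeSquare]
  have : (volume : Measure ((ℝ × ℝ) × (ℝ × ℝ))).IsAddHaarMeasure :=
    Measure.prod.instIsAddHaarMeasure (volume : Measure (ℝ × ℝ)) (volume : Measure (ℝ × ℝ))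
  refine setLIntegral_eq_top_of_two_pow_mul_le volume
    ((measurableSet_timeSquare T).prod (measurableSet_timeSquare T))
    (fun x hx => ⟨⟨half_mul_mem_Ioc hx.1.1, half_mul_mem_Ioc hx.1.2⟩,
      ⟨half_mul_mem_Ioc hx.2.1, half_mul_mem_Ioc hx.2.2⟩⟩) ?_ ?_
    (measurable_covKernel H d 0).ennreal_ofReal.aemeasurable (fun p _ => ?_) ?_
  · rw [hvol]; exact mul_ne_zero (mul_ne_zero hT' hT') (mul_ne_zero hT' hT')
  · rw [hvol]; finiteness
  · rw [show Module.finrank ℝ ((ℝ × ℝ) × (ℝ × ℝ)) = 4 by simp, ← ENNReal.ofReal_ofNat,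
      ← ENNReal.ofReal_pow (by norm_num), ← ENNReal.ofReal_mul (by norm_num)]
    -- At `ε = 0` the kernel may be negative on degenerate times: a zero determinant raised to a
    -- negative power is `0` by convention. There `ENNReal.ofReal` vanishes.
    rcases le_total 0 (covKernel H d 0 p) with h | h
    · exact ENNReal.ofReal_le_ofReal (covKernel_half_smul_ge hH0 hH1 hHd h)
    · rw [ENNReal.ofReal_of_nonpos (by linarith)]; exact zero_le
  · filter_upwards [hgen] with p hp
    rw [ne_eq, ENNReal.ofReal_eq_zero, not_le]
    exact covKernel_zero_pos hH0 hH1 hd hp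

lemma tendsto_nhdsGT_zero_id : Tendsto (fun ε : ℝ => ε) (𝓝[>] 0) (𝓝 0) :=
  tendsto_id.mono_left nhdsWithin_le_nhds

lemma integrable_add_rpow {ε : ℝ} (hε : 0 < ε) :
    Integrable (fun z => (2 * Real.pi) ^ (-(d : ℝ) / 2) * (fbmDiffVar H z + ε) ^ (-(d : ℝ) / 2))
      (timeBox T) := by
  refine (Integrable.of_bound (Measurable.aestronglyMeasurable (by fun_prop))
    (ε ^ (-(d : ℝ) / 2)) (ae_of_all _ fun z => ?_)).const_mul _
  have h := fbmDiffVar_nonneg H z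
  rw [Real.norm_of_nonneg (by positivity)]
  exact Real.rpow_le_rpow_of_nonpos hε (by linarith) (neg_natCast_div_two_nonpos d)

lemma integrable_add_mul_add_sub_rpow (hH0 : 0 < H) (hH1 : H < 1) {ε : ℝ} (hε : 0 < ε) :
    Integrable (fun p : (ℝ × ℝ) × (ℝ × ℝ) => (2 * Real.pi) ^ (-(d : ℝ)) *
      ((fbmDiffVar H p.1 + ε) * (fbmDiffVar H p.2 + ε) - fbmDiffCov H p ^ 2) ^ (-(d : ℝ) / 2))
      ((timeBox T).prod (timeBox T)) := by
  refine (Integrable.of_bound (Measurable.aestronglyMeasurable (by fun_prop))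
    ((ε ^ 2) ^ (-(d : ℝ) / 2)) (ae_of_all _ fun p => ?_)).const_mul _
  have h := sq_le_add_mul_add_sub hH0 hH1 hε p
  rw [Real.norm_of_nonneg (Real.rpow_nonneg ((sq_nonneg ε).trans h) _)]
  exact Real.rpow_le_rpow_of_nonpos (by positivity) h (neg_natCast_div_two_nonpos d)

lemma integrable_covKernel (hH0 : 0 < H) (hH1 : H < 1) {ε : ℝ} (hε : 0 < ε) :
    Integrable (covKernel H d ε) ((timeBox T).prod (timeBox T)) :=
  (integrable_add_mul_add_sub_rpow hH0 hH1 hε).sub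
    ((integrable_add_rpow hε).mul_prod (integrable_add_rpow hε))

lemma tendsto_integral_add_rpow_atTop (hT : 0 < T) (hHd : 2 ≤ H * d) :
    Tendsto (fun ε => ∫ z, (2 * Real.pi) ^ (-(d : ℝ) / 2) *
      (fbmDiffVar H z + ε) ^ (-(d : ℝ) / 2) ∂timeBox T) (𝓝[>] 0) atTop := by
  refine tendsto_integral_atTop_of_lintegral_eq_top
    (fun ε => Measurable.aemeasurable (by fun_prop)) (fun ε hε => integrable_add_rpow hε)
    (fun ε hε => ae_of_all _ fun z => ?_) ?_ (lintegral_fbmDiffVar_rpow_eq_top hT hHd)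
  · have h := fbmDiffVar_nonneg H z
    have hpi := Real.pi_pos
    simp only [Pi.zero_apply]
    positivity
  · filter_upwards [ae_timeBox_pos T] with z hz
    have h := fbmDiffVar_pos H hz.1
    refine Tendsto.const_mul _ (Tendsto.rpow_const ?_ (Or.inl h.ne'))
    simpa using tendsto_nhdsGT_zero_id.const_add (fbmDiffVar H z)

lemma tendsto_integral_covKernel_atTop (hH0 : 0 < H) (hH1 : H < 1) (hd : 0 < d) (hT : 0 < T)
    (hHd : 2 ≤ H * d) :
    Tendsto (fun ε => ∫ p, covKernel H d ε p ∂((timeBox T).prod (timeBox T))) (𝓝[>] 0) atTop := by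
  refine tendsto_integral_atTop_of_lintegral_eq_top
    (fun ε => (measurable_covKernel H d ε).aemeasurable)
    (fun ε hε => integrable_covKernel hH0 hH1 hε)
    (fun ε hε => ae_of_all _ (covKernel_nonneg hH0 hH1 hε)) ?_
    (lintegral_covKernel_eq_top hH0 hH1 hd hT hHd)
  filter_upwards [ae_isGenericTimes T] with p hp
  have h1 : 0 < fbmDiffVar H p.1 := fbmDiffVar_pos H hp.1
  have h2 : 0 < fbmDiffVar H p.2 := fbmDiffVar_pos H hp.2.1
  have h3 := fbmDiffVar_mul_sub_sq_pos hH0 hH1 hp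
  have hcont : ContinuousAt (fun ε => covKernel H d ε p) 0 := by
    unfold covKernel
    refine ContinuousAt.sub (continuousAt_const.mul (ContinuousAt.rpow_const (by fun_prop) ?_))
      ((continuousAt_const.mul (ContinuousAt.rpow_const (by fun_prop) ?_)).mul
        (continuousAt_const.mul (ContinuousAt.rpow_const (by fun_prop) ?_)))
    · simpa using Or.inl h3.ne'
    · simpa using Or.inl h1.ne'
    · simpa using Or.inl h2.ne'
  exact hcont.tendsto.mono_left nhdsWithin_le_nhds

end Divergence

/-! ### Convergence of the second moments when Hd < 2 -/

section Convergence

variable {H T : ℝ} {d : ℕ}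

/-- Regularization only increases the determinant, so the kernels with positive parameters lie below
the limit kernel, which local nondeterminism dominates by an integrable function. -/
lemma tendsto_integral_add_mul_add_sub_rpow (hH0 : 0 < H) (hH1 : H < 1) (hHd : H * d < 2) :
    Tendsto (fun q : ℝ × ℝ => ∫ p, (2 * Real.pi) ^ (-(d : ℝ)) *
        ((fbmDiffVar H p.1 + q.1) * (fbmDiffVar H p.2 + q.2) - fbmDiffCov H p ^ 2) ^ (-(d : ℝ) / 2)
        ∂((timeBox T).prod (timeBox T))) (𝓝[>] 0 ×ˢ 𝓝[>] 0)
      (𝓝 (∫ p, (2 * Real.pi) ^ (-(d : ℝ)) *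
        (fbmDiffVar H p.1 * fbmDiffVar H p.2 - fbmDiffCov H p ^ 2) ^ (-(d : ℝ) / 2)
        ∂((timeBox T).prod (timeBox T)))) := by
  have hpi := Real.pi_pos
  have hint := ((integrable_timeBox_prod_of_lt_one (a := H * d / 2) (by linarith) T).const_mul
    (((2 - 2 ^ H) / 4) ^ (-(d : ℝ) / 2))).const_mul ((2 * Real.pi) ^ (-(d : ℝ)))
  refine tendsto_integral_filter_of_dominated_convergence _
    (Eventually.of_forall fun q => Measurable.aestronglyMeasurable (by fun_prop)) ?_ hint ?_
  · have hpos : ∀ᶠ q : ℝ × ℝ in 𝓝[>] 0 ×ˢ 𝓝[>] 0, 0 < q.1 ∧ 0 < q.2 :=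
      (eventually_mem_nhdsWithin (a := (0 : ℝ)) (s := Set.Ioi 0)).prod_mk
        (eventually_mem_nhdsWithin (a := (0 : ℝ)) (s := Set.Ioi 0))
    filter_upwards [hpos] with q hq
    filter_upwards [ae_isGenericTimes T] with p hp
    have h1 := fbmDiffVar_nonneg H p.1
    have h2 := fbmDiffVar_nonneg H p.2
    have h3 := fbmDiffVar_mul_sub_sq_pos hH0 hH1 hp
    have h4 : fbmDiffVar H p.1 * fbmDiffVar H p.2 - fbmDiffCov H p ^ 2 ≤
        (fbmDiffVar H p.1 + q.1) * (fbmDiffVar H p.2 + q.2) - fbmDiffCov H p ^ 2 :=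
      sub_le_sub_right (mul_le_mul (by linarith) (by linarith) h2 (by linarith)) _
    rw [Real.norm_of_nonneg (mul_nonneg (by positivity) (Real.rpow_nonneg (h3.le.trans h4) _))]
    refine mul_le_mul_of_nonneg_left ?_ (by positivity)
    exact (Real.rpow_le_rpow_of_nonpos h3 h4 (neg_natCast_div_two_nonpos d)).trans
      (fbmDiffVar_mul_sub_sq_rpow_le hH0 hH1 hp d)
  · filter_upwards [ae_isGenericTimes T] with p hp
    have h3 := fbmDiffVar_mul_sub_sq_pos hH0 hH1 hp
    refine Tendsto.const_mul _ (Tendsto.rpow_const ?_ (Or.inl h3.ne'))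
    have h1 : Tendsto (fun q : ℝ × ℝ => fbmDiffVar H p.1 + q.1) (𝓝[>] 0 ×ˢ 𝓝[>] 0)
        (𝓝 (fbmDiffVar H p.1 + 0)) := (tendsto_nhdsGT_zero_id.comp tendsto_fst).const_add _
    have h2 : Tendsto (fun q : ℝ × ℝ => fbmDiffVar H p.2 + q.2) (𝓝[>] 0 ×ˢ 𝓝[>] 0)
        (𝓝 (fbmDiffVar H p.2 + 0)) := (tendsto_nhdsGT_zero_id.comp tendsto_snd).const_add _
    simpa only [add_zero] using (h1.mul h2).sub_const (fbmDiffCov H p ^ 2)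

end Convergence

/-! ### The dichotomy at Hd = 2 -/

theorem theorem1 {Ω : Type*} [MeasurableSpace Ω] (P : Measure Ω) [IsProbabilityMeasure P]
    (d : ℕ) (hd : 2 ≤ d) (H : ℝ) (hH0 : 0 < H) (hH1 : H < 1) (T : ℝ) (hT : 0 < T)
    (B B' : ℝ≥0 → Ω → EuclideanSpace ℝ (Fin d))
    (hB : IsFractionalBrownianMotion H B P) (hB' : IsFractionalBrownianMotion H B' P)
    (hindep : IndepFun (fun ω t => B t ω) (fun ω t => B' t ω) P)
    (hBm : IsJointlyAEMeasurable B T P) (hBm' : IsJointlyAEMeasurable B' T P) :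
    (∀ ε : ℝ, 0 < ε → MemLp (approxILT B B' T ε) 2 P) ∧
    (H * d < 2 → ConvergesInL2 (approxILT B B' T) P) ∧
    (2 ≤ H * d →
      Tendsto (fun ε : ℝ => ∫ ω, approxILT B B' T ε ω ∂P) (𝓝[>] 0) atTop ∧
      Tendsto (fun ε : ℝ => variance (approxILT B B' T ε) P) (𝓝[>] 0) atTop) ∧
    (ConvergesInL2 (approxILT B B' T) P ↔ H * d < 2) := by
  have hmem : ∀ ε : ℝ, 0 < ε → MemLp (approxILT B B' T ε) 2 P :=
    fun ε hε => memLp_approxILT hT.le hBm hBm' hε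
  have hconv : H * d < 2 → ConvergesInL2 (approxILT B B' T) P := fun hHd => by
    refine convergesInL2_of_tendsto_integral_mul hmem
      ((tendsto_integral_add_mul_add_sub_rpow (T := T) hH0 hH1 hHd).congr' ?_)
    have hpos : ∀ᶠ q : ℝ × ℝ in 𝓝[>] 0 ×ˢ 𝓝[>] 0, 0 < q.1 ∧ 0 < q.2 :=
      (eventually_mem_nhdsWithin (a := (0 : ℝ)) (s := Set.Ioi 0)).prod_mk
        (eventually_mem_nhdsWithin (a := (0 : ℝ)) (s := Set.Ioi 0))
    filter_upwards [hpos] with q hq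
    exact (integral_approxILT_mul hH0 hB hB' hindep hT.le hBm hBm' hH1 hq.1 hq.2).symm
  have hmean : 2 ≤ H * d →
      Tendsto (fun ε : ℝ => ∫ ω, approxILT B B' T ε ω ∂P) (𝓝[>] 0) atTop := fun hHd => by
    refine (tendsto_integral_add_rpow_atTop hT hHd).congr' ?_
    filter_upwards [self_mem_nhdsWithin] with ε hε
    exact (integral_approxILT hH0 hB hB' hindep hT.le hBm hBm' hε).symm
  refine ⟨hmem, hconv, fun hHd => ⟨hmean hHd, ?_⟩, fun h => ?_, hconv⟩
  · refine (tendsto_integral_covKernel_atTop hH0 hH1 (by omega) hT hHd).congr' ?_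
    filter_upwards [self_mem_nhdsWithin] with ε hε
    rw [Set.mem_Ioi] at hε
    simp only [covKernel]
    -- The squared mean is itself an integral over quadruples of times, so the variance is the
    -- integral of one kernel, the difference of the two integrands.
    rw [variance_eq_sub (hmem ε hε), integral_sub (integrable_add_mul_add_sub_rpow hH0 hH1 hε)
      ((integrable_add_rpow hε).mul_prod (integrable_add_rpow hε)), integral_prod_mul
        (fun z => (2 * Real.pi) ^ (-(d : ℝ) / 2) * (fbmDiffVar H z + ε) ^ (-(d : ℝ) / 2))
        (fun z => (2 * Real.pi) ^ (-(d : ℝ) / 2) * (fbmDiffVar H z + ε) ^ (-(d : ℝ) / 2)),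
      ← integral_approxILT_mul hH0 hB hB' hindep hT.le hBm hBm' hH1 hε hε,
      ← integral_approxILT hH0 hB hB' hindep hT.le hBm hBm' hε]
    simp only [Pi.pow_apply, sq]
  · by_contra hHd
    exact h.not_tendsto_integral_atTop (hmean (not_lt.1 hHd))
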